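/- **Notation.** Let $\mathbb H$ be the quaternions with the Euclidean norm $|\cdot|$, $B(q_0,R)=\{q\in\mathbb H:|q-q_0|<R\}$, $\mathbb B=B(0,1)$, $\mathbb S=\{I\in\mathbb H: I^2=-1\}$, $\mathbb C_I=\mathbb R+\mathbb R I$ and $B(0,R)_I=B(0,R)\cap\mathbb C_I$ for $I\in\mathbb S$. A function $f:\mathbb B\to\mathbb H$ is *slice regular* if for every $I\in\mathbb S$ its restriction $f_I$ to $\mathbb B\cap\mathbb C_I$ has continuous partial derivatives and satisfies $\frac12\left(\frac{\partial}{\partial x}+I\frac{\partial}{\partial y}\right)f_I(x+yI)=0$; its slice derivative $f'$ is given on $\mathbb B\cap\mathbb C_I$ by $f'(x+yI)=\frac12\left(\frac{\partial}{\partial x}-I\frac{\partial}{\partial y}\right)f_I(x+yI)$. The Bloch seminorm is $\|f\|_{\mathcal B_r}=\sup_{q\in\mathbb B}(1-|q|^2)|f'(q)|$, and $\mathcal B_r$ is the set of slice regular $f$ on $\mathbb B$ with $\|f\|_{\mathcal B_r}<\infty$. For slice regular $f$ on $\mathbb B$ let $B_f\in[0,\infty]$ be the least upper bound of all $R>0$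 for which there are $q_0\in\mathbb H$ and a domain $\Omega\subset\mathbb B$ such that $f|_\Omega:\Omega\to B(q_0,R)$ is a homeomorphism, and set $$\mathbf B_r=\inf\{B_f: f\in\mathcal B_r,\ f(0)=0,\ f'(0)=1,\ \|f\|_{\mathcal B_r}\le 1\}.$$ **Theorem 1.2.** Let $f\in\mathcal B_r$ be such that $f(0)=0$, $f'(0)=1$ and $\|f\|_{\mathcal B_r}\le1$. Then: (a) For all $q\in B(0,1/\sqrt3)$, $$\operatorname{Re} f'(q)\ \ge\ \frac{1-\sqrt3\,|q|}{(1-|q|/\sqrt3)^3}.$$ In particular, $f|_{B(0,1/\sqrt3)_I}:B(0,1/\sqrt3)_I\to\mathbb H$ is injective for every $I\in\mathbb S$. (b) $f$ is injective on $B(0,r_{\mathbb B})$ and $B(0,R_{\mathbb B})\subset f(B(0,r_{\mathbb B}))$, where $$r_{\mathbb B}=\sup_{0<r<1}\left\{\frac12\log\frac{1+r}{1-r}-\sqrt{\frac14\Big(\log\frac{1+r}{1-r}\Big)^2-r^2}\right\}\approx0.3552,$$ $$R_{\mathbb B}=\sup_{0<r<1}\left\{\frac1{2r^2}\log\frac{1+r}{1-r}\left(\frac12\log\frac{1+r}{1-r}-\sqrt{\frac14\Big(\log\frac{1+r}{1-r}\Big)^2-r^2}\right)^2\right\}\approx0.2308$$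 (both suprema are finite, and the decimals are correct to within $5\cdot10^{-5}$). Moreover, $B(0,\sqrt3/4)\subset f(B(0,1/\sqrt3))$. Consequently, $\mathbf B_r>0.23$. -/

import Mathlib

open Set Metric
open scoped Quaternion ENNReal

noncomputable section

namespace SliceBloch

/-- The unit sphere `𝕊 = {q : q² = -1}` of purely imaginary quaternions. -/
def imagSphere : Set ℍ := {I | I ^ 2 = -1}

/-- The point `x + y I`. -/
def slicePoint (I : ℍ) (x y : ℝ) : ℍ := (x : ℍ) + (y : ℍ) * I

/-- The plane `ℂ_I = ℝ ⊕ ℝ I`. -/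
def slicePlane (I : ℍ) : Set ℍ := {q | ∃ x y : ℝ, q = slicePoint I x y}

/-- The partial derivative `∂/∂x` of `f_I`, at `x + y I`. -/
def partialX (f : ℍ → ℍ) (I : ℍ) (x y : ℝ) : ℍ :=
  deriv (fun s : ℝ => f (slicePoint I s y)) x

/-- The partial derivative `∂/∂y` of `f_I`, at `x + y I`. -/
def partialY (f : ℍ → ℍ) (I : ℍ) (x y : ℝ) : ℍ :=
  deriv (fun t : ℝ => f (slicePoint I x t)) y

/-- `f` is slice regular on the open set `Ω`: for every `I ∈ 𝕊` the restriction `f_I` to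
`Ω_I = Ω ∩ ℂ_I` is continuously differentiable as a function of the real variables `(x, y)`,
and `½ (∂/∂x + I ∂/∂y) f_I (x + y I) = 0` at all `x + y I ∈ Ω_I`. -/
def IsSliceRegularOn (f : ℍ → ℍ) (Ω : Set ℍ) : Prop :=
  ∀ I ∈ imagSphere,
    ContDiffOn ℝ 1 (fun p : ℝ × ℝ => f (slicePoint I p.1 p.2))
      {p : ℝ × ℝ | slicePoint I p.1 p.2 ∈ Ω} ∧
    ∀ x y : ℝ, slicePoint I x y ∈ Ω →
      (1 / 2 : ℝ) • (partialX f I x y + I * partialY f I x y) = 0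

/-- The `I`-derivative `∂_I f (x + y I) = ½ (∂/∂x - I ∂/∂y) f_I (x + y I)`. -/
def derivAlong (f : ℍ → ℍ) (I : ℍ) (x y : ℝ) : ℍ :=
  (1 / 2 : ℝ) • (partialX f I x y - I * partialY f I x y)

/-- The quaternion `i`. -/
def quatI : ℍ := ⟨0, 1, 0, 0⟩

open Classical in
/-- The imaginary unit `I` in `q = x + y I`, `y = |Im q|`: it is `Im q / |Im q|` if `Im q ≠ 0`,
and an arbitrary element of `𝕊` (here `i`) if `q` is real. -/
def imagUnit (q : ℍ) : ℍ :=
  if q.im = 0 then quatI else ((‖q.im‖⁻¹ : ℝ) : ℍ) * q.im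

/-- The slice derivative `f'` of `f`: the function equal to `∂_I f` on each `ℂ_I`. For slice
regular `f` it does not depend on how a point is written as `x + y I`:
see `sliceDeriv_slicePoint`. -/
def sliceDeriv (f : ℍ → ℍ) (q : ℍ) : ℍ := derivAlong f (imagUnit q) q.re ‖q.im‖

/-- The Bloch seminorm `sup_{q ∈ 𝔹} (1 - |q|²) |f'(q)|`, as a value in `[0, ∞]`. -/
def blochSeminorm (f : ℍ → ℍ) : ℝ≥0∞ :=
  ⨆ q ∈ ball (0 : ℍ) 1, ENNReal.ofReal ((1 - ‖q‖ ^ 2) * ‖sliceDeriv f q‖)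

/-- The slice regular Bloch space on `𝔹`. -/
def IsBloch (f : ℍ → ℍ) : Prop :=
  IsSliceRegularOn f (ball 0 1) ∧ blochSeminorm f < ⊤

/-- `f` maps some domain `Ω ⊆ 𝔹` homeomorphically onto the ball `B(q₀, R)`. -/
def HasUnivalentBall (f : ℍ → ℍ) (R : ℝ) : Prop :=
  ∃ (q₀ : ℍ) (Ω : Set ℍ), IsOpen Ω ∧ IsConnected Ω ∧ Ω ⊆ ball 0 1 ∧
    ∃ e : Ω ≃ₜ ball q₀ R, ∀ p : Ω, (e p : ℍ) = f p

/-- `B_f`: the least upper bound, in `[0, ∞]`, of the radii `R > 0` of the balls onto which `f`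
maps some domain `Ω ⊆ 𝔹` homeomorphically. -/
def blochRadius (f : ℍ → ℍ) : ℝ≥0∞ :=
  ⨆ (R : ℝ) (_ : 0 < R ∧ HasUnivalentBall f R), ENNReal.ofReal R

/-- The Bloch constant `𝐁_r`, the infimum of `B_f` over the normalized Bloch functions. -/
def blochConstant : ℝ≥0∞ :=
  ⨅ (f : ℍ → ℍ) (_ : IsBloch f ∧ f 0 = 0 ∧ sliceDeriv f 0 = 1 ∧ blochSeminorm f ≤ 1),
    blochRadius f

/-- `½ log((1 + r)/(1 - r)) - √(¼ (log((1 + r)/(1 - r)))² - r²)`. -/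
def injTerm (r : ℝ) : ℝ :=
  1 / 2 * Real.log ((1 + r) / (1 - r)) -
    Real.sqrt (1 / 4 * (Real.log ((1 + r) / (1 - r))) ^ 2 - r ^ 2)

/-- `1/(2r²) · log((1 + r)/(1 - r)) · (½ log((1 + r)/(1 - r)) - √(…))²`. -/
def coverTerm (r : ℝ) : ℝ :=
  1 / (2 * r ^ 2) * Real.log ((1 + r) / (1 - r)) * injTerm r ^ 2

/-- `r_𝔹`. -/
def injRadius : ℝ := sSup (injTerm '' Ioo 0 1)

/-- `R_𝔹`. -/
def coverRadius : ℝ := sSup (coverTerm '' Ioo 0 1)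

theorem slicePoint_neg (I : ℍ) (x y : ℝ) : slicePoint (-I) x (-y) = slicePoint I x y := by
  simp [slicePoint]

theorem derivAlong_neg (f : ℍ → ℍ) (I : ℍ) (x y : ℝ) :
    derivAlong f (-I) x (-y) = derivAlong f I x y := by
  have h : partialY f (-I) x (-y) = - partialY f I x y := by
    unfold partialY
    have h2 : (fun t : ℝ => f (slicePoint (-I) x t)) =
        fun t : ℝ => (fun s : ℝ => f (slicePoint I x s)) (-t) := by
      funext t
      have := slicePoint_neg I x (-t)
      rw [neg_neg] at this
      simp only [this]
    have h3 := deriv_comp_neg (fun s : ℝ => f (slicePoint I x s)) (-y)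
    rw [neg_neg] at h3
    rw [h2]
    exact h3
  simp only [derivAlong, h, partialX, slicePoint_neg]
  simp

theorem imagSphere_re {I : ℍ} (hI : I ∈ imagSphere) : I.re = 0 ∧ ‖I‖ = 1 := by
  have h : I ^ 2 = -1 := hI
  have hn : ‖I‖ = 1 := by
    have h2 : ‖I‖ ^ 2 = 1 := by rw [← norm_pow, h]; simp
    nlinarith [norm_nonneg I]
  refine ⟨?_, hn⟩
  have h0 := congrArg QuaternionAlgebra.re h
  have h1 := congrArg QuaternionAlgebra.imI h
  have h2 := congrArg QuaternionAlgebra.imJ h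
  have h3 := congrArg QuaternionAlgebra.imK h
  simp [pow_two] at h0 h1 h2 h3
  by_contra hre
  have e1 : I.imI = 0 := by
    have : I.re * I.imI = 0 := by linarith
    simpa [hre] using this
  have e2 : I.imJ = 0 := by
    have : I.re * I.imJ = 0 := by linarith
    simpa [hre] using this
  have e3 : I.imK = 0 := by
    have : I.re * I.imK = 0 := by linarith
    simpa [hre] using this
  rw [e1, e2, e3] at h0
  nlinarith [sq_nonneg I.re]

theorem quatI_mem : quatI ∈ imagSphere := by
  have h0 : quatI.re = 0 := rfl
  have h1 : quatI.imI = 1 := rfl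
  have h2 : quatI.imJ = 0 := rfl
  have h3 : quatI.imK = 0 := rfl
  change quatI ^ 2 = -1
  rw [pow_two]
  ext <;> simp [h0, h1, h2, h3]

/-- The slice derivative of a slice regular function is well defined. -/
theorem sliceDeriv_slicePoint {f : ℍ → ℍ} {Ω : Set ℍ} (hf : IsSliceRegularOn f Ω)
    {I : ℍ} (hI : I ∈ imagSphere) {x y : ℝ} (hq : slicePoint I x y ∈ Ω) :
    sliceDeriv f (slicePoint I x y) = derivAlong f I x y := by
  obtain ⟨hre, hn⟩ := imagSphere_re hI
  have r1 : (slicePoint I x y).re = x := by simp [slicePoint, hre]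
  have hIim : I.im = I := by ext <;> simp [hre]
  have r2 : (slicePoint I x y).im = (y : ℍ) * I := by
    ext <;> simp [slicePoint, hre]
  have r3 : ‖(slicePoint I x y).im‖ = |y| := by
    rw [r2, norm_mul, hn, mul_one]; simp
  have hI0 : I ≠ 0 := by
    intro h; rw [h] at hn; simp at hn
  unfold sliceDeriv
  rw [r1, r3]
  rcases lt_trichotomy y 0 with hy | hy | hy
  · have : imagUnit (slicePoint I x y) = -I := by
      have hne : (slicePoint I x y).im ≠ 0 := by
        intro h; rw [h, norm_zero] at r3; exact hy.ne (abs_eq_zero.1 r3.symm)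
      rw [imagUnit, if_neg hne, r3, r2, ← mul_assoc, ← Quaternion.coe_mul, abs_of_neg hy]
      have : (-y)⁻¹ * y = -1 := by rw [inv_neg, neg_mul, inv_mul_cancel₀ hy.ne]
      rw [this]; simp
    rw [this, abs_of_neg hy, derivAlong_neg]
  · subst hy
    have key : ∀ J ∈ imagSphere, derivAlong f J x 0 = deriv (fun s : ℝ => f (s : ℍ)) x := by
      intro J hJ
      have e : slicePoint J x 0 = slicePoint I x 0 := by simp [slicePoint]
      have h := (hf J hJ).2 x 0 (e ▸ hq)
      have h2 : partialX f J x 0 + J * partialY f J x 0 = 0 := by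
        exact (smul_eq_zero.1 h).resolve_left (by norm_num)
      have h3 : J * partialY f J x 0 = - partialX f J x 0 := by
        rw [eq_neg_iff_add_eq_zero, add_comm]; exact h2
      rw [derivAlong, h3, sub_neg_eq_add, ← two_smul ℝ, smul_smul]
      norm_num [partialX, slicePoint]
    have hu : imagUnit (slicePoint I x 0) ∈ imagSphere := by
      have : (slicePoint I x 0).im = 0 := by rw [r2]; simp
      rw [imagUnit, if_pos this]
      exact quatI_mem
    rw [abs_zero, key _ hu, key _ hI]
  · have : imagUnit (slicePoint I x y) = I := by
      have hne : (slicePoint I x y).im ≠ 0 := by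
        intro h; rw [h, norm_zero] at r3; exact hy.ne' (abs_eq_zero.1 r3.symm)
      rw [imagUnit, if_neg hne, r3, r2, ← mul_assoc, ← Quaternion.coe_mul, abs_of_pos hy]
      have : y⁻¹ * y = 1 := by field_simp
      rw [this]; simp
    rw [this, abs_of_pos hy]

end SliceBloch

end

/-!
# Distortion, injectivity and covering for slice regular Bloch functions

A slice regular function `f` on the unit ball has a *holomorphic stem*: a holomorphic function
`A` from the unit disc to `ℍ ⊗ ℂ`, here `Fin 4 → ℂ`, such that on every slice `f(x + y I)` is
obtained from `A(x + i y)` by letting the imaginary unit of `ℂ` act as left multiplication by `I`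
(`exists_isStem`). The stem of `f'` is the derivative of `A`. With it the theorem becomes a
statement about scalar holomorphic functions on the disc.

**Distortion.** The `ℂ_I` component `F` of `f'` on a slice is a scalar holomorphic function with
`Re F = Re f'`, `F(0) = 1` and `|F(z)| (1 - |z|²) ≤ 1`, so Bonk's distortion theorem applies to it
(`bonk_distortion`). That theorem follows from Julia's boundary Schwarz lemma for the self-map
`u ↦ -4 F(√3 (u + 1) / (3 + u)) / (3 + u)²` of the disc at its boundary fixed point `-1`.
Integration along segments gives the injectivity on slices and the bound `|f| ≥ √3 / 4` on the
sphere of radius `1 / √3`.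

**Injectivity.** An element of `ℍ ⊗ ℂ` is killed by the evaluation at some imaginary unit exactly
when it is isotropic for the complexified squared norm `nsq` (`nsq_eq_zero_iff`). Hence `f` takes
the value `w` on the sphere of `z` if and only if the scalar function `nsq (A z - w)` vanishes at
`z`. It factors as `(l₁ - |w|) (l₂ - |w|)`, where `|l₁|` and `|l₂|` are values of `|f|` on the
sphere of `z` (`exists_eigenvalues`). If `|f| < M` and `f(0) = 0`, the product of the two
Möbius transforms of the `lⱼ` is a scalar function bounded by one whose value at the origin is
`|w|² / M²`. If `f(p) = f(q) = w` with `p ≠ q`, it has four zeros, the points of the two spheres,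
which gives `|w| ≤ M |p| |q|` (`IsStem.norm_le_mul_mul`). With the lower bound for `|f(p)|` from
the Schwarz–Pick inequality this is Landau's theorem. It is applied to `q ↦ f(rq)`, bounded by
`artanh r` because `|f'(q)| ≤ 1 / (1 - |q|²)`; then `r_𝔹` and `R_𝔹` are the suprema over `r`.

**Covering.** If `|f| ≥ R` on a sphere centred at `0` and `|w| < R`, and `f` omitted `w` inside, the
reciprocal of the corresponding product of Möbius transforms would be holomorphic and violate the
maximum principle (`IsStem.ball_subset_image`). A continuous injection of this kind is a
homeomorphism over the covered ball (`hasUnivalentBall_of_injOn`), whence the Bloch constant.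

**Numerics.** An upper bound `b` for the first supremum amounts to the inequality
`artanh r ≥ (r² + b²) / (2b)`, and an upper bound `B` for the second to
`artanh (2Bs³ / (1 + s²)) ≥ B s²`. The constants are chosen so that the difference of the two sides
has its critical minimum at an explicit point.
-/

namespace SliceBloch

open Filter Topology ComplexConjugate

/-! ### Bounded holomorphic functions on the unit disc -/

theorem one_sub_conj_mul_ne_zero {a z : ℂ} (ha : ‖a‖ < 1) (hz : ‖z‖ ≤ 1) :
    1 - conj a * z ≠ 0 := by
  intro h
  have h1 : conj a * z = 1 := (sub_eq_zero.1 h).symm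
  have h2 : ‖a‖ * ‖z‖ = 1 := by
    have := congrArg norm h1
    simpa using this
  nlinarith [norm_nonneg a, norm_nonneg z]

theorem normSq_one_sub_conj_mul_sub (a z : ℂ) :
    ‖1 - conj a * z‖ ^ 2 - ‖z - a‖ ^ 2 = (1 - ‖a‖ ^ 2) * (1 - ‖z‖ ^ 2) := by
  simp only [← Complex.normSq_eq_norm_sq, Complex.normSq_apply]
  simp
  ring

/-- Division by a Blaschke factor: a function bounded by one on the disc and vanishing at `a` is
the product of the Blaschke factor of `a` and a function bounded by one. -/
theorem exists_blaschke_factor {g : ℂ → ℂ} (hg : DifferentiableOn ℂ g (ball 0 1))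
    (hb : ∀ z ∈ ball (0 : ℂ) 1, ‖g z‖ ≤ 1) {a : ℂ} (ha : a ∈ ball (0 : ℂ) 1) (h0 : g a = 0) :
    ∃ k : ℂ → ℂ, DifferentiableOn ℂ k (ball 0 1) ∧ (∀ z ∈ ball (0 : ℂ) 1, ‖k z‖ ≤ 1) ∧
      ∀ z ∈ ball (0 : ℂ) 1, g z * (1 - conj a * z) = (z - a) * k z := by
  have ha1 : ‖a‖ < 1 := by simpa using ha
  have hden : ∀ z ∈ ball (0 : ℂ) 1, 1 + conj a * z ≠ 0 := by
    intro z hz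
    have := one_sub_conj_mul_ne_zero (a := -a) (z := z) (by simpa)
      (by simpa using (mem_ball_zero_iff.1 hz).le)
    simpa using this
  -- The automorphism `z ↦ (z + a) / (1 + āz)` moves the zero to the origin.
  have hmob : MapsTo (fun z : ℂ => (z + a) / (1 + conj a * z)) (ball 0 1) (ball 0 1) := by
    intro z hz
    have h1 := normSq_one_sub_conj_mul_sub (-a) z
    have hz1 : ‖z‖ < 1 := by simpa using hz
    have hne := hden z hz
    simp only [map_neg, neg_mul, sub_neg_eq_add, norm_neg] at h1
    rw [mem_ball_zero_iff, norm_div, div_lt_one (norm_pos_iff.2 hne)]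
    have : 0 < (1 - ‖a‖ ^ 2) * (1 - ‖z‖ ^ 2) := by
      apply mul_pos <;> nlinarith [norm_nonneg a, norm_nonneg z]
    exact lt_of_pow_lt_pow_left₀ 2 (norm_nonneg _) (by linarith)
  have hmd : DifferentiableOn ℂ (fun z : ℂ => (z + a) / (1 + conj a * z)) (ball 0 1) := by
    apply DifferentiableOn.div (by fun_prop) (by fun_prop) hden
  have hcomp : DifferentiableOn ℂ (fun z : ℂ => g ((z + a) / (1 + conj a * z))) (ball 0 1) :=
    hg.comp hmd hmob
  have key : ∀ z ∈ ball (0 : ℂ) 1, ‖g z‖ * ‖1 - conj a * z‖ ≤ ‖z - a‖ := by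
    intro z hz
    have hz1 : ‖z‖ < 1 := by simpa using hz
    have hne := one_sub_conj_mul_ne_zero ha1 hz1.le
    have hne2 := one_sub_conj_mul_ne_zero ha1 ha1.le
    have hζ : ‖(z - a) / (1 - conj a * z)‖ < 1 := by
      have h1 := normSq_one_sub_conj_mul_sub a z
      rw [norm_div, div_lt_one (norm_pos_iff.2 hne)]
      have : 0 < (1 - ‖a‖ ^ 2) * (1 - ‖z‖ ^ 2) := by
        apply mul_pos <;> nlinarith [norm_nonneg a, norm_nonneg z]
      exact lt_of_pow_lt_pow_left₀ 2 (norm_nonneg _) (by linarith)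
    have h2 := Complex.norm_le_norm_of_mapsTo_ball hcomp
      (fun w hw => by simpa using hb _ (hmob hw)) (by simpa using h0) hζ
    have h3 : ((z - a) / (1 - conj a * z) + a) / (1 + conj a * ((z - a) / (1 - conj a * z))) = z := by
      have e1 : 1 + conj a * ((z - a) / (1 - conj a * z)) =
          (1 - conj a * a) / (1 - conj a * z) := by field_simp; ring
      have e2 : (z - a) / (1 - conj a * z) + a =
          z * (1 - conj a * a) / (1 - conj a * z) := by
        rw [div_add' _ _ _ hne]; ring
      rw [e1, e2, div_div_div_cancel_right₀ hne, mul_div_assoc, div_self hne2, mul_one]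
    simp only [h3] at h2
    rw [norm_div, le_div_iff₀ (norm_pos_iff.2 hne)] at h2
    exact h2
  refine ⟨fun z => dslope g a z * (1 - conj a * z), ?_, ?_, ?_⟩
  · apply DifferentiableOn.mul
    · exact (Complex.differentiableOn_dslope (isOpen_ball.mem_nhds ha)).2 hg
    · fun_prop
  · have hcont : ContinuousOn (fun z => dslope g a z * (1 - conj a * z)) (ball 0 1) := by
      apply ContinuousOn.mul
      · exact ((Complex.differentiableOn_dslope (isOpen_ball.mem_nhds ha)).2 hg).continuousOn
      · fun_prop
    have hne : ∀ z ∈ ball (0 : ℂ) 1, z ≠ a → ‖dslope g a z * (1 - conj a * z)‖ ≤ 1 := by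
      intro z hz hza
      have := key z hz
      rw [dslope_of_ne _ hza, slope_def_field, h0, sub_zero, norm_mul, norm_div, div_mul_eq_mul_div,
        div_le_one (norm_pos_iff.2 (sub_ne_zero.2 hza))]
      exact this
    intro z hz
    by_cases hza : z = a
    · subst hza
      have h1 : Tendsto (fun w => ‖dslope g z w * (1 - conj z * w)‖) (𝓝[≠] z)
          (𝓝 ‖dslope g z z * (1 - conj z * z)‖) :=
        ((hcont.continuousAt (isOpen_ball.mem_nhds hz)).norm.tendsto).mono_left nhdsWithin_le_nhds
      refine le_of_tendsto h1 ?_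
      filter_upwards [self_mem_nhdsWithin, nhdsWithin_le_nhds (isOpen_ball.mem_nhds hz)] with w hw hw2
      exact hne w hw2 hw
    · exact hne z hz hza
  · intro z hz
    have h1 := sub_smul_dslope g a z
    rw [h0, sub_zero, smul_eq_mul] at h1
    rw [← h1]
    ring

/-- The **Schwarz–Pick** inequality for holomorphic self-maps of the disc. -/
theorem schwarz_pick {g : ℂ → ℂ} (hg : DifferentiableOn ℂ g (ball 0 1))
    (hb : ∀ z ∈ ball (0 : ℂ) 1, ‖g z‖ < 1) {u v : ℂ} (hu : u ∈ ball (0 : ℂ) 1)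
    (hv : v ∈ ball (0 : ℂ) 1) :
    ‖g u - g v‖ * ‖1 - conj v * u‖ ≤ ‖u - v‖ * ‖1 - conj (g v) * g u‖ := by
  have hne : ∀ z ∈ ball (0 : ℂ) 1, 1 - conj (g v) * g z ≠ 0 := fun z hz =>
    one_sub_conj_mul_ne_zero (hb v hv) (hb z hz).le
  obtain ⟨k, -, hk, hfac⟩ := exists_blaschke_factor
    (g := fun z => (g z - g v) / (1 - conj (g v) * g z))
    ((hg.sub_const _).div ((hg.const_mul _).const_sub _) hne)
    (by
      intro z hz
      rw [norm_div, div_le_one (norm_pos_iff.2 (hne z hz))]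
      have h1 := normSq_one_sub_conj_mul_sub (g v) (g z)
      have : 0 < (1 - ‖g v‖ ^ 2) * (1 - ‖g z‖ ^ 2) := by
        apply mul_pos <;> nlinarith [norm_nonneg (g v), norm_nonneg (g z), hb v hv, hb z hz]
      exact le_of_sq_le_sq (by linarith) (norm_nonneg _)) hv (by simp)
  have h1 := congrArg norm (hfac u hu)
  simp only [norm_mul, norm_div] at h1
  have hp := norm_pos_iff.2 (hne u hu)
  have h2 : ‖u - v‖ * ‖k u‖ ≤ ‖u - v‖ * 1 :=
    mul_le_mul_of_nonneg_left (hk u hu) (norm_nonneg _)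
  rw [← h1, mul_one, div_mul_eq_mul_div, div_le_iff₀ hp] at h2
  exact h2

/-- A function bounded by one on the disc is bounded at the origin by the product of the moduli
of its zeros, counted with multiplicity. -/
theorem norm_le_prod_zeros (Z : Multiset ℂ) (hZ : ∀ b ∈ Z, b ∈ ball (0 : ℂ) 1) {g : ℂ → ℂ}
    (hg : DifferentiableOn ℂ g (ball 0 1)) (hb : ∀ z ∈ ball (0 : ℂ) 1, ‖g z‖ ≤ 1)
    (hord : ∀ b ∈ ball (0 : ℂ) 1, (Z.count b : ℕ∞) ≤ analyticOrderAt g b) :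
    ‖g 0‖ ≤ (Z.map norm).prod := by
  induction Z using Multiset.induction_on generalizing g with
  | empty => simpa using hb 0 (by simp)
  | cons a Z ih =>
    have ha : a ∈ ball (0 : ℂ) 1 := hZ a (Multiset.mem_cons_self a Z)
    have hga : g a = 0 := by
      have h1 := hord a ha
      rw [Multiset.count_cons_self] at h1
      apply apply_eq_zero_of_analyticOrderAt_ne_zero
      intro h
      rw [h] at h1
      simp at h1
    obtain ⟨k, hk, hk1, hfac⟩ := exists_blaschke_factor hg hb ha hga
    have h0 : ‖g 0‖ = ‖a‖ * ‖k 0‖ := by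
      have := congrArg norm (hfac 0 (by simp))
      simpa using this
    rw [h0, Multiset.map_cons, Multiset.prod_cons]
    refine mul_le_mul_of_nonneg_left (ih (fun b hbZ => hZ b (Multiset.mem_cons_of_mem hbZ)) hk hk1 ?_)
      (norm_nonneg _)
    intro b hbb
    have hga' : AnalyticAt ℂ g b := hg.analyticAt (isOpen_ball.mem_nhds hbb)
    have hka : AnalyticAt ℂ k b := hk.analyticAt (isOpen_ball.mem_nhds hbb)
    have hne : 1 - conj a * b ≠ 0 :=
      one_sub_conj_mul_ne_zero (by simpa using ha) (by simpa using (mem_ball_zero_iff.1 hbb).le)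
    have e1 : analyticOrderAt (fun z => 1 - conj a * z) b = 0 := by
      rw [analyticOrderAt_eq_zero]; exact Or.inr hne
    have hA : AnalyticAt ℂ (fun z : ℂ => 1 - conj a * z) b := by fun_prop
    have hB : AnalyticAt ℂ (fun z : ℂ => z - a) b := by fun_prop
    have e2 : analyticOrderAt (g * fun z => 1 - conj a * z) b =
        analyticOrderAt ((fun z => z - a) * k) b := by
      apply analyticOrderAt_congr
      filter_upwards [isOpen_ball.mem_nhds hbb] with z hz
      exact hfac z hz
    rw [analyticOrderAt_mul hga' hA, analyticOrderAt_mul hB hka, e1, add_zero] at e2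
    have h2 := hord b hbb
    rw [e2] at h2
    by_cases hba : b = a
    · subst hba
      rw [Multiset.count_cons_self, analyticOrderAt_id_sub_const_self] at h2
      push_cast at h2
      rw [add_comm] at h2
      exact (ENat.add_le_add_iff_left (by simp)).1 h2
    · rw [Multiset.count_cons_of_ne hba, analyticOrderAt_id_sub_const_of_ne hba, zero_add] at h2
      exact h2

theorem normSq_moebius (M m : ℝ) (w : ℂ) :
    ‖(M : ℂ) ^ 2 - m * w‖ ^ 2 - ‖(M : ℂ) * (w - m)‖ ^ 2 =
      (M ^ 2 - m ^ 2) * (M ^ 2 - ‖w‖ ^ 2) := by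
  simp only [← Complex.normSq_eq_norm_sq, Complex.normSq_apply]
  simp [pow_two]
  ring

/-- The lower bound for the modulus of a function bounded by `M` on the disc whose value at the
origin is `m`. -/
theorem le_norm_of_schwarz_pick {h : ℂ → ℂ} (hh : DifferentiableOn ℂ h (ball 0 1)) {m M : ℝ}
    (hm : 0 < m) (hmM : m < M) (hb : ∀ z ∈ ball (0 : ℂ) 1, ‖h z‖ ≤ M) (h0 : h 0 = m) {z : ℂ}
    (hz : z ∈ ball (0 : ℂ) 1) : M * (m - M * ‖z‖) / (M - m * ‖z‖) ≤ ‖h z‖ := by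
  have hM : 0 < M := hm.trans hmM
  have hz1 : ‖z‖ < 1 := by simpa using hz
  set t := ‖z‖ with ht
  have ht0 : 0 ≤ t := norm_nonneg z
  -- The Möbius transform of `h` vanishing at the origin.
  have hne : ∀ z ∈ ball (0 : ℂ) 1, (M : ℂ) ^ 2 - m * h z ≠ 0 := by
    intro z hz hzero
    have h1 : (M : ℂ) ^ 2 = m * h z := sub_eq_zero.1 hzero
    have h2 := congrArg norm h1
    simp only [norm_pow, norm_mul, Complex.norm_real, Real.norm_eq_abs, abs_of_pos hM,
      abs_of_pos hm] at h2
    nlinarith [hb z hz]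
  have hle : ‖(M : ℂ) * (h z - m)‖ ≤ t * ‖(M : ℂ) ^ 2 - m * h z‖ := by
    have := Complex.norm_le_norm_of_mapsTo_ball (R := 1)
      (f := fun z => (M : ℂ) * (h z - m) / ((M : ℂ) ^ 2 - m * h z))
      (((hh.sub_const _).const_mul _).div ((hh.const_mul _).const_sub _) hne)
      (by
        intro w hw
        rw [mem_closedBall_zero_iff, norm_div, div_le_one (norm_pos_iff.2 (hne w hw))]
        have h1 := normSq_moebius M m (h w)
        have : 0 ≤ (M ^ 2 - m ^ 2) * (M ^ 2 - ‖h w‖ ^ 2) := by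
          apply mul_nonneg <;> nlinarith [norm_nonneg (h w), hb w hw]
        exact le_of_sq_le_sq (by linarith) (norm_nonneg _)) (by simp [h0]) hz1
    rwa [norm_div, div_le_iff₀ (norm_pos_iff.2 (hne z hz))] at this
  have h1 := normSq_moebius M m (h z)
  have h2 : ‖(M : ℂ) * (h z - m)‖ ^ 2 = M ^ 2 * (‖h z‖ ^ 2 - 2 * m * (h z).re + m ^ 2) := by
    simp only [← Complex.normSq_eq_norm_sq, Complex.normSq_apply]
    simp
    ring
  have h3 : ‖(M : ℂ) * (h z - m)‖ ^ 2 ≤ t ^ 2 * ‖(M : ℂ) ^ 2 - m * h z‖ ^ 2 := by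
    rw [← mul_pow]; gcongr
  have h4 : (h z).re ≤ ‖h z‖ := (le_abs_self _).trans (Complex.abs_re_le_norm _)
  set x := ‖h z‖ with hx
  have hx0 : 0 ≤ x := norm_nonneg _
  have hden : 0 < M - m * t := by nlinarith
  have hden2 : 0 < M + m * t := by nlinarith
  have ht2 : t ^ 2 ≤ 1 := by nlinarith
  -- The two roots of the quadratic polynomial in `x` bounding `x` from below and above.
  have h5 : (x * (M - m * t) - M * (m - M * t)) * (x * (M + m * t) - M * (m + M * t)) ≤ 0 := by
    have e1 : ‖(M : ℂ) ^ 2 - m * h z‖ ^ 2 =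
        M ^ 2 * (x ^ 2 - 2 * m * (h z).re + m ^ 2) + (M ^ 2 - m ^ 2) * (M ^ 2 - x ^ 2) := by
      rw [← h2, ← h1]; ring
    rw [h2, e1] at h3
    have h6 : 0 ≤ 2 * m * M ^ 2 * (1 - t ^ 2) * (x - (h z).re) := by
      apply mul_nonneg (mul_nonneg (by positivity) (by linarith)) (by linarith)
    nlinarith
  rw [div_le_iff₀ hden]
  by_contra hcon
  push Not at hcon
  have h6 : 0 ≤ x * (M + m * t) - M * (m + M * t) := by
    by_contra h7
    push Not at h7
    nlinarith [mul_pos_of_neg_of_neg (sub_neg.2 hcon) h7]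
  have h7 := mul_lt_mul_of_pos_right hcon hden2
  have h8 := mul_nonneg h6 hden.le
  have h9 : 0 ≤ M * (t * ((M - m) * (M + m))) :=
    mul_nonneg hM.le (mul_nonneg ht0 (mul_nonneg (by linarith) (by linarith)))
  nlinarith

/-! ### A boundary Schwarz lemma and the distortion theorem for holomorphic functions -/

/-- **Julia's lemma** at the boundary point `-1`, on the real diameter. -/
theorem re_le_of_julia {ψ : ℂ → ℂ} (hψ : DifferentiableOn ℂ ψ (ball 0 1))
    (hb : ∀ z ∈ ball (0 : ℂ) 1, ‖ψ z‖ < 1) (h1 : ψ (-1) = -1) (h2 : HasDerivAt ψ 1 (-1)) {u : ℝ}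
    (hu : -1 < u) (hu' : u < 1) : (ψ u).re ≤ u := by
  have hu1 : (u : ℂ) ∈ ball (0 : ℂ) 1 := by
    simpa [abs_lt] using ⟨hu, hu'⟩
  -- The boundary dilatation coefficient `lim (1 - |ψ v|²) / (1 - v²)` at `-1` equals one.
  have hre : HasDerivAt (fun v : ℝ => 1 - ‖ψ v‖ ^ 2) 2 (-1) := by
    have e1 : HasDerivAt (fun v : ℝ => ψ v) 1 (-1) := by
      have := HasDerivAt.comp_ofReal (z := -1) (by simpa using h2)
      simpa using this
    have e2 := (e1.norm_sq).const_sub 1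
    refine e2.congr_deriv ?_
    simp [h1]
  have hq : HasDerivAt (fun v : ℝ => 1 - v ^ 2) 2 (-1) := by
    have := ((hasDerivAt_id (-1 : ℝ)).pow 2).const_sub 1
    refine (this.congr_deriv ?_)
    norm_num
  have hlim : Tendsto (fun v : ℝ => (1 - ‖ψ v‖ ^ 2) / (1 - v ^ 2)) (𝓝[>] (-1)) (𝓝 1) := by
    have t1 := (hasDerivAt_iff_tendsto_slope.1 hre).mono_left
      (nhdsWithin_mono _ (fun x (hx : -1 < x) => hx.ne'))
    have t2 := (hasDerivAt_iff_tendsto_slope.1 hq).mono_left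
      (nhdsWithin_mono _ (fun x (hx : -1 < x) => hx.ne'))
    have t3 := t1.div t2 (by norm_num)
    rw [div_self (by norm_num)] at t3
    refine t3.congr' ?_
    filter_upwards [self_mem_nhdsWithin] with v (hv : -1 < v)
    have : v - -1 ≠ 0 := by linarith
    simp only [Pi.div_apply, slope_def_field]
    rw [div_div_div_cancel_right₀ this]
    simp [h1]
  have hψc : Tendsto (fun v : ℝ => ψ v) (𝓝[>] (-1)) (𝓝 (-1)) := by
    have : Tendsto (fun v : ℝ => ψ v) (𝓝 (-1)) (𝓝 (ψ (-1))) := by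
      have h3 : ContinuousAt (fun v : ℝ => ψ v) (-1) := by
        apply ContinuousAt.comp (f := fun v : ℝ => (v : ℂ)) (g := ψ)
        · simpa using h2.continuousAt
        · fun_prop
      simpa [ContinuousAt] using h3
    rw [h1] at this
    exact this.mono_left nhdsWithin_le_nhds
  have hvc : Tendsto (fun v : ℝ => (v : ℂ)) (𝓝[>] (-1)) (𝓝 (-1)) := by
    have : Tendsto (fun v : ℝ => (v : ℂ)) (𝓝 (-1)) (𝓝 ((-1 : ℝ) : ℂ)) :=
      Complex.continuous_ofReal.tendsto _
    push_cast at this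
    exact this.mono_left nhdsWithin_le_nhds
  have key : ∀ᶠ v : ℝ in 𝓝[>] (-1), (1 - u ^ 2) * ‖1 - conj (ψ v) * ψ u‖ ^ 2 ≤
      (1 - ‖ψ u‖ ^ 2) * ‖1 - conj (v : ℂ) * u‖ ^ 2 * ((1 - ‖ψ v‖ ^ 2) / (1 - v ^ 2)) := by
    have : Ioo (-1 : ℝ) 1 ∈ 𝓝[>] (-1 : ℝ) := Ioo_mem_nhdsGT (by norm_num)
    filter_upwards [this] with v hv
    have hv1 : (v : ℂ) ∈ ball (0 : ℂ) 1 := by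
      simpa [abs_lt] using hv
    have p1 := schwarz_pick hψ hb hu1 hv1
    have p2 : (‖ψ u - ψ v‖ * ‖1 - conj (v : ℂ) * u‖) ^ 2 ≤
        (‖(u : ℂ) - v‖ * ‖1 - conj (ψ v) * ψ u‖) ^ 2 := by gcongr
    have q1 := normSq_one_sub_conj_mul_sub (ψ v) (ψ u)
    have q2 := normSq_one_sub_conj_mul_sub (v : ℂ) u
    have e3 : ‖(u : ℂ)‖ ^ 2 = u ^ 2 := by simp
    have e4 : ‖(v : ℂ)‖ ^ 2 = v ^ 2 := by simp
    rw [e3, e4] at q2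
    have hvp : 0 < 1 - v ^ 2 := by nlinarith [hv.1, hv.2]
    rw [← mul_div_assoc, le_div_iff₀ hvp]
    rw [mul_pow, mul_pow] at p2
    nlinarith
  have l1 : Tendsto (fun v : ℝ => (1 - u ^ 2) * ‖1 - conj (ψ v) * ψ u‖ ^ 2) (𝓝[>] (-1))
      (𝓝 ((1 - u ^ 2) * ‖1 - conj (-1) * ψ u‖ ^ 2)) :=
    ((((((Complex.continuous_conj.tendsto _).comp hψc).mul_const _).const_sub 1).norm).pow
      2).const_mul _
  have l2 : Tendsto (fun v : ℝ => (1 - ‖ψ u‖ ^ 2) * ‖1 - conj (v : ℂ) * u‖ ^ 2 *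
      ((1 - ‖ψ v‖ ^ 2) / (1 - v ^ 2))) (𝓝[>] (-1))
      (𝓝 ((1 - ‖ψ u‖ ^ 2) * ‖1 - conj (-1) * (u : ℂ)‖ ^ 2 * 1)) :=
    (((((((Complex.continuous_conj.tendsto _).comp hvc).mul_const _).const_sub 1).norm).pow
      2).const_mul _).mul hlim
  have h3 := le_of_tendsto_of_tendsto l1 l2 key
  have h4 := hb u hu1
  have e5 : ‖1 - conj (-1) * (u : ℂ)‖ ^ 2 = (1 + u) ^ 2 := by
    simp only [← Complex.normSq_eq_norm_sq, Complex.normSq_apply]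
    simp
    ring
  have e6 : ‖1 - conj (-1) * ψ u‖ ^ 2 = (1 + (ψ u).re) ^ 2 + (ψ u).im ^ 2 := by
    simp only [← Complex.normSq_eq_norm_sq, Complex.normSq_apply]
    simp
    ring
  have e7 : ‖ψ u‖ ^ 2 = (ψ u).re ^ 2 + (ψ u).im ^ 2 := by
    simp only [← Complex.normSq_eq_norm_sq, Complex.normSq_apply]
    ring
  have h5 : ‖ψ u‖ ^ 2 < 1 := by nlinarith [norm_nonneg (ψ u)]
  rw [e5, e6, e7, mul_one] at h3
  rw [e7] at h5
  set X := (ψ u).re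
  set Y := (ψ u).im
  have hX : -1 < X := by nlinarith [sq_nonneg Y]
  have h6 : (1 + u) * ((1 - u) * ((1 + X) ^ 2 + Y ^ 2)) ≤
      (1 + u) * ((1 - (X ^ 2 + Y ^ 2)) * (1 + u)) := by nlinarith
  have h7 := le_of_mul_le_mul_left h6 (by linarith)
  have h8 : (1 + X) * ((1 - u) * (1 + X)) ≤ (1 + X) * ((1 - X) * (1 + u)) := by
    nlinarith [sq_nonneg Y]
  have h9 := le_of_mul_le_mul_left h8 (by linarith)
  nlinarith

/-- The derivative at the origin vanishes if `|H(z)| (1 - |z|²)` is maximal there. -/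
theorem deriv_zero_of_bloch {H : ℂ → ℂ} (hH : DifferentiableOn ℂ H (ball 0 1)) (h0 : H 0 = 1)
    (hb : ∀ z ∈ ball (0 : ℂ) 1, (1 - ‖z‖ ^ 2) * ‖H z‖ ≤ 1) : deriv H 0 = 0 := by
  have hd : HasDerivAt H (deriv H 0) 0 :=
    (hH.differentiableAt (isOpen_ball.mem_nhds (by simp))).hasDerivAt
  -- Along each ray the real function `(1 - t²) Re H(te)` has a local maximum at `0`.
  have hray : ∀ e : ℂ, ‖e‖ = 1 → (e * deriv H 0).re = 0 := by
    intro e he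
    have h1 : HasDerivAt (fun t : ℝ => H (t * e)) (e * deriv H 0) 0 := by
      have h2 : HasDerivAt (fun t : ℂ => H (t * e)) (e * deriv H 0) ((0 : ℝ) : ℂ) := by
        have h3 : HasDerivAt (fun t : ℂ => t * e) e ((0 : ℝ) : ℂ) := by
          simpa using (hasDerivAt_id ((0 : ℝ) : ℂ)).mul_const e
        have h4 := HasDerivAt.comp ((0 : ℝ) : ℂ) (h₂ := H) (h₂' := deriv H 0) (by simpa using hd) h3
        simpa [mul_comm, Function.comp_def] using h4
      exact h2.comp_ofReal
    have h5 : HasDerivAt (fun t : ℝ => (H (t * e)).re) (e * deriv H 0).re 0 :=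
      (Complex.reCLM.hasFDerivAt.comp_hasDerivAt (0 : ℝ) h1)
    have h6 : HasDerivAt (fun t : ℝ => (1 - t ^ 2) * (H (t * e)).re) (e * deriv H 0).re 0 := by
      have h7 : HasDerivAt (fun t : ℝ => 1 - t ^ 2) 0 0 := by
        have := ((hasDerivAt_id (0 : ℝ)).pow 2).const_sub 1
        refine (this.congr_deriv ?_)
        norm_num
      refine (h7.mul h5).congr_deriv ?_
      simp
    refine IsLocalMax.hasDerivAt_eq_zero ?_ h6
    have : Ioo (-1 : ℝ) 1 ∈ 𝓝 (0 : ℝ) := Ioo_mem_nhds (by norm_num) (by norm_num)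
    filter_upwards [this] with t ht
    have hn : ‖(t : ℂ) * e‖ = |t| := by simp [he]
    have h8 := hb (t * e) (by rw [mem_ball_zero_iff, hn, abs_lt]; exact ht)
    rw [hn, sq_abs] at h8
    have h9 : 0 ≤ 1 - t ^ 2 := by nlinarith [ht.1, ht.2]
    have h10 : (H (t * e)).re ≤ ‖H (t * e)‖ := (le_abs_self _).trans (Complex.abs_re_le_norm _)
    simp only [Complex.ofReal_zero, zero_mul, h0]
    norm_num
    nlinarith [mul_le_mul_of_nonneg_left h10 h9]
  have h1 := hray 1 (by simp)
  have h2 := hray Complex.I (by simp)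
  apply Complex.ext
  · simpa using h1
  · simpa using h2

/-- Bonk's distortion theorem on the positive radius: in the coordinate `u`, where
`x = √3 (u + 1) / (3 + u)`, the function `-4 H(x) / (3 + u)²` is a self-map of the disc to
which Julia's lemma applies. -/
theorem bonk_distortion_pos {H : ℂ → ℂ} (hH : DifferentiableOn ℂ H (ball 0 1)) (h0 : H 0 = 1)
    (hb : ∀ z ∈ ball (0 : ℂ) 1, (1 - ‖z‖ ^ 2) * ‖H z‖ ≤ 1) {x : ℝ} (hx : 0 < x)
    (hx' : x < 1 / √3) : (1 - √3 * x) / (1 - x / √3) ^ 3 ≤ (H x).re := by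
  have h3 : (√3) ^ 2 = 3 := Real.sq_sqrt (by norm_num)
  have h3p : 0 < √3 := by positivity
  have hne : ∀ u : ℂ, ‖u‖ < 3 → 3 + u ≠ 0 := by
    intro u hu h
    have : u = -3 := by linear_combination h
    rw [this] at hu
    norm_num at hu
  set T : ℂ → ℂ := fun u => (√3 : ℂ) * (u + 1) / (3 + u) with hT
  have hnT : ∀ u : ℂ, ‖u‖ < 3 → (1 - ‖T u‖ ^ 2) * ‖3 + u‖ ^ 2 = 6 - 2 * ‖u‖ ^ 2 := by
    intro u hu
    have hp : ‖3 + u‖ ≠ 0 := norm_ne_zero_iff.2 (hne u hu)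
    simp only [hT, norm_div, norm_mul, Complex.norm_real, Real.norm_eq_abs, abs_of_pos h3p, div_pow,
      mul_pow, h3]
    rw [sub_mul, div_mul_cancel₀ _ (pow_ne_zero 2 hp)]
    simp only [← Complex.normSq_eq_norm_sq, Complex.normSq_apply]
    simp
    ring
  have hTmem : ∀ u : ℂ, ‖u‖ ^ 2 < 3 → T u ∈ ball (0 : ℂ) 1 := by
    intro u hu
    have hu3 : ‖u‖ < 3 := by nlinarith [norm_nonneg u]
    have h4 := hnT u hu3
    have h5 : 0 < ‖3 + u‖ ^ 2 := pow_pos (norm_pos_iff.2 (hne u hu3)) 2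
    rw [mem_ball_zero_iff]
    by_contra hcon
    push Not at hcon
    have : 1 ≤ ‖T u‖ ^ 2 := one_le_pow₀ hcon
    nlinarith
  have hTd : ∀ u : ℂ, ‖u‖ < 3 → HasDerivAt T (2 * √3 / (3 + u) ^ 2) u := by
    intro u hu
    have := (((hasDerivAt_id u).add_const 1).const_mul (√3 : ℂ)).div
      ((hasDerivAt_id u).const_add 3) (hne u hu)
    refine this.congr_deriv ?_
    simp
    ring
  set ψ : ℂ → ℂ := fun u => -4 * H (T u) / (3 + u) ^ 2 with hψ
  have hψd : DifferentiableOn ℂ ψ (ball 0 1) := by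
    intro u hu
    have hu1 : ‖u‖ < 1 := by simpa using hu
    have hu3 : ‖u‖ < 3 := by linarith
    have d1 : DifferentiableAt ℂ (fun u => H (T u)) u :=
      (hH.differentiableAt (isOpen_ball.mem_nhds (hTmem u (by nlinarith [norm_nonneg u])))).comp u
        (hTd u hu3).differentiableAt
    have d2 : DifferentiableAt ℂ (fun u : ℂ => (3 + u) ^ 2) u := by fun_prop
    exact ((d1.const_mul _).div d2 (pow_ne_zero 2 (hne u hu3))).differentiableWithinAt
  have hψb : ∀ u ∈ ball (0 : ℂ) 1, ‖ψ u‖ < 1 := by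
    intro u hu
    have hu1 : ‖u‖ < 1 := by simpa using hu
    have hu3 : ‖u‖ < 3 := by linarith
    have hsq : ‖u‖ ^ 2 < 1 := by nlinarith [norm_nonneg u]
    have h4 := hnT u hu3
    have h5 := hb _ (hTmem u (by linarith))
    have h6 : 0 < ‖3 + u‖ ^ 2 := pow_pos (norm_pos_iff.2 (hne u hu3)) 2
    simp only [hψ, norm_div, norm_mul, norm_neg, norm_pow]
    rw [div_lt_one h6]
    have h7 : (6 - 2 * ‖u‖ ^ 2) * ‖H (T u)‖ ≤ ‖3 + u‖ ^ 2 := by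
      rw [← h4]; nlinarith
    norm_num
    by_cases hz : ‖H (T u)‖ = 0
    · rw [hz]; simpa using h6
    · have : 0 < ‖H (T u)‖ := lt_of_le_of_ne (norm_nonneg _) (Ne.symm hz)
      nlinarith
  have hT1 : T (-1) = 0 := by simp [hT]
  have hψ1 : ψ (-1) = -1 := by
    simp only [hψ, hT1, h0]; norm_num
  have hψ2 : HasDerivAt ψ 1 (-1) := by
    have hH0 : HasDerivAt H 0 (T (-1)) := by
      rw [hT1]
      exact (hH.differentiableAt (ball_mem_nhds 0 one_pos)).hasDerivAt.congr_deriv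
        (deriv_zero_of_bloch hH h0 hb)
    have hT2 := hTd (-1) (by norm_num)
    have d1 := HasDerivAt.comp (-1 : ℂ) hH0 hT2
    have d2 := (d1.const_mul (-4 : ℂ)).div (((hasDerivAt_id (-1 : ℂ)).const_add 3).pow 2)
      (by norm_num)
    refine d2.congr_deriv ?_
    simp [hT1, h0]
    norm_num
  have hx3 : √3 * x < 1 := by
    rw [lt_div_iff₀ h3p] at hx'; linarith
  have hxs : x < √3 := by nlinarith
  -- The inverse change of variable.
  set u : ℝ := (3 * x - √3) / (√3 - x) with hu
  have hpos : 0 < √3 - x := by linarith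
  have hu0 : u < 0 := by
    apply div_neg_of_neg_of_pos _ hpos
    nlinarith
  have hu1 : -1 < u := by
    rw [hu, lt_div_iff₀ hpos]; linarith
  have hTu : T u = x := by
    have h5 : (3 : ℝ) + u ≠ 0 := by linarith
    have : √3 * (u + 1) / (3 + u) = x := by
      rw [div_eq_iff h5, hu]
      field_simp
      ring
    simp only [hT]
    exact_mod_cast this
  have hj := re_le_of_julia hψd hψb hψ1 hψ2 hu1 (by linarith)
  have hval : ((ψ u).re : ℝ) = -4 * (H x).re / (3 + u) ^ 2 := by
    have : ψ u = ((-4 / (3 + u) ^ 2 : ℝ) : ℂ) * H x := by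
      simp only [hψ, hTu]
      push_cast
      ring
    rw [this, Complex.re_ofReal_mul]
    ring
  have hup : 0 < (3 + u) ^ 2 := by nlinarith
  rw [hval, div_le_iff₀ hup] at hj
  have hF : (1 - √3 * x) / (1 - x / √3) ^ 3 = -u * (3 + u) ^ 2 / 4 := by
    have e1 : 3 + u = 2 * √3 / (√3 - x) := by
      rw [hu]; field_simp; ring
    have e2 : 1 - x / √3 = (√3 - x) / √3 := by field_simp
    rw [e1, e2, hu]
    field_simp
    linear_combination (-4 * x) * h3
  rw [hF]
  linarith

/-- **Bonk's distortion theorem**. -/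
theorem bonk_distortion {H : ℂ → ℂ} (hH : DifferentiableOn ℂ H (ball 0 1)) (h0 : H 0 = 1)
    (hb : ∀ z ∈ ball (0 : ℂ) 1, (1 - ‖z‖ ^ 2) * ‖H z‖ ≤ 1) {z : ℂ} (hz : ‖z‖ < 1 / √3) :
    (1 - √3 * ‖z‖) / (1 - ‖z‖ / √3) ^ 3 ≤ (H z).re := by
  by_cases hz0 : z = 0
  · subst hz0
    simp [h0]
  have hzp : 0 < ‖z‖ := norm_pos_iff.2 hz0
  set e : ℂ := z / ‖z‖ with he
  have hen : ‖e‖ = 1 := by simp [he, hzp.ne']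
  have hmaps : MapsTo (fun w : ℂ => e * w) (ball 0 1) (ball 0 1) := by
    intro w hw
    simpa [hen] using hw
  have h1 := bonk_distortion_pos (H := fun w => H (e * w)) (hH.comp (by fun_prop) hmaps)
    (by simpa using h0)
    (by
      intro w hw
      have := hb (e * w) (hmaps hw)
      simpa [hen] using this) hzp hz
  have h2 : e * (‖z‖ : ℂ) = z := by
    rw [he, div_mul_cancel₀]
    exact_mod_cast hzp.ne'
  simpa only [h2] using h1

/-! ### Complexified quaternions and their evaluations on the slices -/

/-- The real part of an element `X` of `ℍ ⊗ ℂ`, given by its four complex coordinates. -/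
noncomputable def reQ (X : Fin 4 → ℂ) : ℍ := ⟨(X 0).re, (X 1).re, (X 2).re, (X 3).re⟩

/-- The imaginary part of an element `X` of `ℍ ⊗ ℂ`, given by its four complex coordinates. -/
noncomputable def imQ (X : Fin 4 → ℂ) : ℍ := ⟨(X 0).im, (X 1).im, (X 2).im, (X 3).im⟩

/-- The evaluation `ℍ ⊗ ℂ → ℍ` that sends the imaginary unit of `ℂ` to left multiplication by
`I`. -/
noncomputable def ev (I : ℍ) (X : Fin 4 → ℂ) : ℍ := reQ X + I * imQ X

/-- The quaternion `w` as a real element of `ℍ ⊗ ℂ`. -/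
noncomputable def ofQ (w : ℍ) : Fin 4 → ℂ := ![w.re, w.imI, w.imJ, w.imK]

/-- The quadratic form `Σ Xⱼ²` on `ℍ ⊗ ℂ`, complexifying the squared norm of `ℍ`. -/
noncomputable def nsq (X : Fin 4 → ℂ) : ℂ := X 0 ^ 2 + X 1 ^ 2 + X 2 ^ 2 + X 3 ^ 2

/-- The bilinear form `Σ Xⱼ wⱼ` for a quaternion `w`. -/
noncomputable def dotQ (X : Fin 4 → ℂ) (w : ℍ) : ℂ :=
  X 0 * w.re + X 1 * w.imI + X 2 * w.imJ + X 3 * w.imK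

/-- The component of `ev I X` in the plane `ℂ_I`, read as a complex number. -/
noncomputable def comp (I : ℍ) (X : Fin 4 → ℂ) : ℂ :=
  X 0 + Complex.I * (I.imI * X 1 + I.imJ * X 2 + I.imK * X 3)

@[simp] theorem reQ_re (X : Fin 4 → ℂ) : (reQ X).re = (X 0).re := rfl
@[simp] theorem reQ_imI (X : Fin 4 → ℂ) : (reQ X).imI = (X 1).re := rfl
@[simp] theorem reQ_imJ (X : Fin 4 → ℂ) : (reQ X).imJ = (X 2).re := rfl
@[simp] theorem reQ_imK (X : Fin 4 → ℂ) : (reQ X).imK = (X 3).re := rfl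
@[simp] theorem imQ_re (X : Fin 4 → ℂ) : (imQ X).re = (X 0).im := rfl
@[simp] theorem imQ_imI (X : Fin 4 → ℂ) : (imQ X).imI = (X 1).im := rfl
@[simp] theorem imQ_imJ (X : Fin 4 → ℂ) : (imQ X).imJ = (X 2).im := rfl
@[simp] theorem imQ_imK (X : Fin 4 → ℂ) : (imQ X).imK = (X 3).im := rfl
@[simp] theorem ofQ_zero (w : ℍ) : ofQ w 0 = w.re := rfl
@[simp] theorem ofQ_one (w : ℍ) : ofQ w 1 = w.imI := rfl
@[simp] theorem ofQ_two (w : ℍ) : ofQ w 2 = w.imJ := rfl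
@[simp] theorem ofQ_three (w : ℍ) : ofQ w 3 = w.imK := rfl

theorem norm_sq_eq (q : ℍ) : ‖q‖ ^ 2 = q.re ^ 2 + q.imI ^ 2 + q.imJ ^ 2 + q.imK ^ 2 := by
  rw [pow_two, ← Quaternion.normSq_eq_norm_mul_self, Quaternion.normSq_def']

theorem mem_imagSphere_iff {I : ℍ} : I ∈ imagSphere ↔ I.re = 0 ∧ ‖I‖ = 1 := by
  refine ⟨imagSphere_re, fun ⟨h0, h1⟩ => ?_⟩
  have h2 := norm_sq_eq I
  rw [h1, h0] at h2
  change I ^ 2 = -1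
  rw [pow_two]
  ext <;> simp [h0] <;> linarith

theorem imagSphere_sq {I : ℍ} (hI : I ∈ imagSphere) :
    I.imI ^ 2 + I.imJ ^ 2 + I.imK ^ 2 = 1 := by
  have h2 := norm_sq_eq I
  rw [(imagSphere_re hI).1, (imagSphere_re hI).2] at h2
  linarith

theorem imagSphere_mul_self {I : ℍ} (hI : I ∈ imagSphere) : I * I = -1 := by
  rw [← pow_two]; exact hI

theorem neg_mem_imagSphere {I : ℍ} (hI : I ∈ imagSphere) : -I ∈ imagSphere := by
  rw [mem_imagSphere_iff] at hI ⊢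
  simpa using hI

theorem imagSphere_ne_neg {I : ℍ} (hI : I ∈ imagSphere) : I ≠ -I := by
  intro h
  have h0 : I + I = 0 := by nth_rewrite 1 [h]; exact neg_add_cancel I
  rw [← two_smul ℝ] at h0
  have h1 : I = 0 := (smul_eq_zero.1 h0).resolve_left two_ne_zero
  have h2 := (imagSphere_re hI).2
  rw [h1] at h2
  simp at h2

/-- The point of `ℂ_I` that corresponds to the complex number `z`. -/
noncomputable abbrev emb (I : ℍ) (z : ℂ) : ℍ := slicePoint I z.re z.im

theorem norm_emb {I : ℍ} (hI : I ∈ imagSphere) (z : ℂ) : ‖emb I z‖ = ‖z‖ := by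
  have h1 := norm_sq_eq (emb I z)
  have h2 := imagSphere_sq hI
  have h3 : ‖z‖ ^ 2 = z.re ^ 2 + z.im ^ 2 := by
    rw [← Complex.normSq_eq_norm_sq, Complex.normSq_apply]; ring
  have h4 : ‖emb I z‖ ^ 2 = ‖z‖ ^ 2 := by
    rw [h1, h3]
    simp [slicePoint, (imagSphere_re hI).1]
    linear_combination (z.im ^ 2) * h2
  exact (pow_left_inj₀ (norm_nonneg _) (norm_nonneg _) two_ne_zero).1 h4

theorem emb_conj (I : ℍ) (z : ℂ) : emb (-I) (conj z) = emb I z := by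
  simp [emb, slicePoint]

theorem imagUnit_mem (q : ℍ) : imagUnit q ∈ imagSphere := by
  unfold imagUnit
  split_ifs with h
  · exact quatI_mem
  · rw [mem_imagSphere_iff]
    refine ⟨by rw [Quaternion.coe_mul_eq_smul, Quaternion.re_smul]; simp, ?_⟩
    rw [norm_mul, Quaternion.norm_coe, norm_inv, norm_norm, inv_mul_cancel₀ (norm_ne_zero_iff.2 h)]

theorem norm_im_mul_imagUnit (q : ℍ) : (‖q.im‖ : ℍ) * imagUnit q = q.im := by
  unfold imagUnit
  split_ifs with h
  · simp [h]
  · rw [← mul_assoc, ← Quaternion.coe_mul, mul_inv_cancel₀ (norm_ne_zero_iff.2 h)]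
    simp

theorem slicePoint_imagUnit (q : ℍ) : slicePoint (imagUnit q) q.re ‖q.im‖ = q := by
  rw [slicePoint, norm_im_mul_imagUnit]
  exact Quaternion.re_add_im q

/-- The complex number `x + i y`, `y ≥ 0`, for which `q` lies on the sphere `x + y 𝕊`. -/
noncomputable def toC (q : ℍ) : ℂ := ⟨q.re, ‖q.im‖⟩

theorem emb_toC (q : ℍ) : emb (imagUnit q) (toC q) = q := slicePoint_imagUnit q

theorem norm_toC (q : ℍ) : ‖toC q‖ = ‖q‖ := by
  rw [← norm_emb (imagUnit_mem q), emb_toC]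

theorem ev_add (I : ℍ) (X Y : Fin 4 → ℂ) : ev I (X + Y) = ev I X + ev I Y := by
  have h1 : reQ (X + Y) = reQ X + reQ Y := by ext <;> simp
  have h2 : imQ (X + Y) = imQ X + imQ Y := by ext <;> simp
  rw [ev, ev, ev, h1, h2, mul_add]; abel

theorem ev_smul {I : ℍ} (hI : I ∈ imagSphere) (c : ℂ) (X : Fin 4 → ℂ) :
    ev I (c • X) = emb I c * ev I X := by
  have h1 : reQ (c • X) = (c.re : ℍ) * reQ X - (c.im : ℍ) * imQ X := by ext <;> simp
  have h2 : imQ (c • X) = (c.re : ℍ) * imQ X + (c.im : ℍ) * reQ X := by ext <;> simp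
  have h3 : ∀ r : ℝ, I * (r : ℍ) = r * I := fun r => (Quaternion.coe_commutes r I).symm
  rw [ev, ev, h1, h2, emb, slicePoint, mul_add, ← mul_assoc, ← mul_assoc, h3, h3, add_mul, mul_add,
    mul_add, mul_assoc (c.im : ℍ) I (I * imQ X), ← mul_assoc I I, imagSphere_mul_self hI]
  simp only [neg_mul, one_mul, mul_neg, mul_assoc]
  abel

theorem ev_neg (I : ℍ) (X : Fin 4 → ℂ) : ev I (-X) = -ev I X := by
  have h1 : reQ (-X) = -reQ X := by ext <;> simp
  have h2 : imQ (-X) = -imQ X := by ext <;> simp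
  rw [ev, ev, h1, h2, mul_neg, neg_add]

theorem ev_sub (I : ℍ) (X Y : Fin 4 → ℂ) : ev I (X - Y) = ev I X - ev I Y := by
  rw [sub_eq_add_neg, ev_add, ev_neg, sub_eq_add_neg]

theorem ev_real_smul (I : ℍ) (r : ℝ) (X : Fin 4 → ℂ) : ev I (r • X) = r • ev I X := by
  have h1 : reQ (r • X) = r • reQ X := by ext <;> simp
  have h2 : imQ (r • X) = r • imQ X := by ext <;> simp
  rw [ev, ev, h1, h2, mul_smul_comm, smul_add]

/-- `ev I` as a continuous real-linear map. -/
noncomputable def evL (I : ℍ) : (Fin 4 → ℂ) →L[ℝ] ℍ :=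
  LinearMap.toContinuousLinearMap
    { toFun := ev I
      map_add' := ev_add I
      map_smul' := ev_real_smul I }

theorem ev_ofQ (I w : ℍ) : ev I (ofQ w) = w := by
  have h1 : reQ (ofQ w) = w := by ext <;> simp
  have h2 : imQ (ofQ w) = 0 := by ext <;> simp
  rw [ev, h1, h2, mul_zero, add_zero]

theorem comp_re {I : ℍ} (hI : I ∈ imagSphere) (X : Fin 4 → ℂ) :
    (comp I X).re = (ev I X).re := by
  simp [comp, ev, (imagSphere_re hI).1]
  ring

theorem comp_im {I : ℍ} (hI : I ∈ imagSphere) (X : Fin 4 → ℂ) :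
    (comp I X).im = -(I * ev I X).re := by
  rw [ev, mul_add, ← mul_assoc, imagSphere_mul_self hI]
  simp [comp, (imagSphere_re hI).1]
  ring

theorem comp_eq_of_ev_eq {I : ℍ} (hI : I ∈ imagSphere) {X Y : Fin 4 → ℂ} (h : ev I X = ev I Y) :
    comp I X = comp I Y := by
  apply Complex.ext
  · rw [comp_re hI, comp_re hI, h]
  · rw [comp_im hI, comp_im hI, h]

theorem norm_comp_le {I : ℍ} (hI : I ∈ imagSphere) (X : Fin 4 → ℂ) :
    ‖comp I X‖ ≤ ‖ev I X‖ := by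
  have h1 : ‖comp I X‖ ^ 2 = (comp I X).re ^ 2 + (comp I X).im ^ 2 := by
    rw [← Complex.normSq_eq_norm_sq, Complex.normSq_apply]; ring
  have h2 : ‖comp I X‖ ^ 2 ≤ ‖ev I X‖ ^ 2 := by
    rw [h1, comp_re hI, comp_im hI, norm_sq_eq]
    generalize ev I X = q
    have h3 := imagSphere_sq hI
    have h4 : -(I * q).re = I.imI * q.imI + I.imJ * q.imJ + I.imK * q.imK := by
      simp [(imagSphere_re hI).1]; ring
    rw [h4]
    have h5 : (I.imI ^ 2 + I.imJ ^ 2 + I.imK ^ 2) * (q.imI ^ 2 + q.imJ ^ 2 + q.imK ^ 2) =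
      q.imI ^ 2 + q.imJ ^ 2 + q.imK ^ 2 := by rw [h3, one_mul]
    nlinarith [sq_nonneg (I.imI * q.imJ - I.imJ * q.imI), sq_nonneg (I.imI * q.imK - I.imK * q.imI),
      sq_nonneg (I.imJ * q.imK - I.imK * q.imJ)]
  exact le_of_sq_le_sq h2 (norm_nonneg _)

/-- An isotropic element of `ℍ ⊗ ℂ` is annihilated by the evaluation at some imaginary unit, and
conversely: this turns the quaternionic equation `f(q) = w` into a scalar one. -/
theorem nsq_eq_zero_iff (X : Fin 4 → ℂ) : nsq X = 0 ↔ ∃ I ∈ imagSphere, ev I X = 0 := by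
  have hre : (nsq X).re = ‖reQ X‖ ^ 2 - ‖imQ X‖ ^ 2 := by
    rw [norm_sq_eq, norm_sq_eq]
    simp [nsq, pow_two]
    ring
  have him : (nsq X).im = 2 * (reQ X * star (imQ X)).re := by
    simp [nsq, pow_two]
    ring
  constructor
  · intro h
    rw [h] at hre him
    simp only [Complex.zero_re, Complex.zero_im] at hre him
    have hn : ‖reQ X‖ = ‖imQ X‖ :=
      (pow_left_inj₀ (norm_nonneg _) (norm_nonneg _) two_ne_zero).1 (by linarith)
    by_cases h0 : imQ X = 0
    · refine ⟨quatI, quatI_mem, ?_⟩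
      have h1 : reQ X = 0 := by rw [← norm_eq_zero, hn, h0, norm_zero]
      rw [ev, h0, h1]; simp
    · have hb := norm_ne_zero_iff.2 h0
      have hinv : (imQ X)⁻¹ = ((‖imQ X‖ ^ 2)⁻¹ : ℝ) • star (imQ X) := by
        rw [pow_two, ← Quaternion.normSq_eq_norm_mul_self]; rfl
      refine ⟨-(reQ X * (imQ X)⁻¹), neg_mem_imagSphere (mem_imagSphere_iff.2 ⟨?_, ?_⟩), ?_⟩
      · rw [hinv, mul_smul_comm, Quaternion.re_smul]
        have : (reQ X * star (imQ X)).re = 0 := by linarith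
        rw [this]; simp
      · rw [norm_mul, norm_inv, hn, mul_inv_cancel₀ hb]
      · rw [ev, neg_mul, mul_assoc, inv_mul_cancel₀ h0, mul_one, add_neg_cancel]
  · rintro ⟨I, hI, h⟩
    have ha : reQ X = -(I * imQ X) := eq_neg_of_add_eq_zero_left h
    have hn : ‖reQ X‖ = ‖imQ X‖ := by
      rw [ha, norm_neg, norm_mul, (imagSphere_re hI).2, one_mul]
    apply Complex.ext
    · rw [hre, hn]; simp
    · rw [him, ha, neg_mul, mul_assoc, Quaternion.self_mul_star]
      simp [(imagSphere_re hI).1]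

theorem eq_zero_of_ev_eq_zero {I K : ℍ} (hIK : I ≠ K) {X : Fin 4 → ℂ} (h1 : ev I X = 0)
    (h2 : ev K X = 0) : X = 0 := by
  have h3 : (I - K) * imQ X = 0 := by
    have : ev I X - ev K X = (I - K) * imQ X := by rw [ev, ev, sub_mul]; abel
    rw [← this, h1, h2, sub_zero]
  have h4 : imQ X = 0 := (mul_eq_zero.1 h3).resolve_left (sub_ne_zero.2 hIK)
  have h5 : reQ X = 0 := by rw [ev, h4, mul_zero, add_zero] at h1; exact h1
  have a0 := congrArg QuaternionAlgebra.re h4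
  have a1 := congrArg QuaternionAlgebra.imI h4
  have a2 := congrArg QuaternionAlgebra.imJ h4
  have a3 := congrArg QuaternionAlgebra.imK h4
  have b0 := congrArg QuaternionAlgebra.re h5
  have b1 := congrArg QuaternionAlgebra.imI h5
  have b2 := congrArg QuaternionAlgebra.imJ h5
  have b3 := congrArg QuaternionAlgebra.imK h5
  funext j
  fin_cases j
  · exact Complex.ext b0 a0
  · exact Complex.ext b1 a1
  · exact Complex.ext b2 a2
  · exact Complex.ext b3 a3

theorem nsq_sub_ofQ (X : Fin 4 → ℂ) (w : ℍ) :
    nsq (X - ofQ w) = nsq X - 2 * dotQ X w + (‖w‖ : ℂ) ^ 2 := by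
  have h : (‖w‖ : ℂ) ^ 2 = (w.re : ℂ) ^ 2 + (w.imI : ℂ) ^ 2 + (w.imJ : ℂ) ^ 2 + (w.imK : ℂ) ^ 2 := by
    exact_mod_cast norm_sq_eq w
  rw [h]
  simp [nsq, dotQ]
  ring

/-- The eigenvalues `l₁, l₂` of `X` relative to the direction of `w`: both are attained, up to a
quaternion of norm one, as values of `ev I X`, and the quadratic forms that measure the position
of `w` relative to `X` factor through them. -/
theorem exists_eigenvalues (X : Fin 4 → ℂ) {w : ℍ} (hw : w ≠ 0) :
    ∃ l₁ l₂ : ℂ, (∃ I ∈ imagSphere, ‖ev I X‖ = ‖l₁‖) ∧ (∃ I ∈ imagSphere, ‖ev I X‖ = ‖l₂‖) ∧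
      nsq X - 2 * dotQ X w + (‖w‖ : ℂ) ^ 2 = (l₁ - ‖w‖) * (l₂ - ‖w‖) ∧
      ∀ M : ℂ, M ^ 4 - M ^ 2 * (2 * dotQ X w) + (‖w‖ : ℂ) ^ 2 * nsq X =
        (M ^ 2 - ‖w‖ * l₁) * (M ^ 2 - ‖w‖ * l₂) := by
  have hw0 : ‖w‖ ≠ 0 := norm_ne_zero_iff.2 hw
  have hwc : (‖w‖ : ℂ) ≠ 0 := by exact_mod_cast hw0
  set u : ℍ := ‖w‖⁻¹ • w with hu
  have hun : ‖u‖ = 1 := by rw [hu, norm_smul, norm_inv, norm_norm, inv_mul_cancel₀ hw0]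
  have hdot : dotQ X w = ‖w‖ * dotQ X u := by
    simp only [dotQ, hu, Quaternion.re_smul, Quaternion.imI_smul, Quaternion.imJ_smul,
      Quaternion.imK_smul, smul_eq_mul, Complex.ofReal_mul, Complex.ofReal_inv]
    field_simp
  obtain ⟨d, hd⟩ := IsAlgClosed.exists_eq_mul_self (dotQ X u ^ 2 - nsq X)
  -- Both roots of `l² - 2 (X·u) l + Σ Xⱼ²` make `X - l u` isotropic.
  have hroot : ∀ l : ℂ, l ^ 2 - 2 * dotQ X u * l + nsq X = 0 →
      ∃ I ∈ imagSphere, ‖ev I X‖ = ‖l‖ := by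
    intro l hl
    have h1 : nsq (X - l • ofQ u) = 0 := by
      rw [← hl]
      have h : (1 : ℂ) = (u.re : ℂ) ^ 2 + (u.imI : ℂ) ^ 2 + (u.imJ : ℂ) ^ 2 + (u.imK : ℂ) ^ 2 := by
        have := norm_sq_eq u
        rw [hun, one_pow] at this
        exact_mod_cast this
      simp [nsq, dotQ]
      linear_combination (-l ^ 2) * h
    obtain ⟨I, hI, h2⟩ := (nsq_eq_zero_iff _).1 h1
    refine ⟨I, hI, ?_⟩
    rw [ev_sub, sub_eq_zero, ev_smul hI, ev_ofQ] at h2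
    rw [h2, norm_mul, hun, mul_one, norm_emb hI]
  refine ⟨dotQ X u + d, dotQ X u - d, hroot _ ?_, hroot _ ?_, ?_, fun M => ?_⟩
  · linear_combination (-1) * hd
  · linear_combination (-1) * hd
  · rw [hdot]; linear_combination (-1) * hd
  · rw [hdot]; linear_combination (-(‖w‖ : ℂ) ^ 2) * hd

/-! ### The holomorphic stem of a slice regular function -/

/-- `A` is a holomorphic stem of `f` on the unit disc: on every slice `f` is the evaluation of the
same holomorphic function with values in `ℍ ⊗ ℂ`. -/
structure IsStem (f : ℍ → ℍ) (A : ℂ → Fin 4 → ℂ) : Prop where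
  diff : DifferentiableOn ℂ A (ball 0 1)
  eq : ∀ I ∈ imagSphere, ∀ z ∈ ball (0 : ℂ) 1, f (emb I z) = ev I (A z)

theorem emb_mem_ball {I : ℍ} (hI : I ∈ imagSphere) {z : ℂ} {r : ℝ} :
    emb I z ∈ ball (0 : ℍ) r ↔ z ∈ ball (0 : ℂ) r := by
  rw [mem_ball_zero_iff, mem_ball_zero_iff, norm_emb hI]

theorem toC_mem_ball {q : ℍ} {r : ℝ} : toC q ∈ ball (0 : ℂ) r ↔ q ∈ ball (0 : ℍ) r := by
  rw [mem_ball_zero_iff, mem_ball_zero_iff, norm_toC]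

theorem emb_ofReal (I : ℍ) (x : ℝ) : emb I (x : ℂ) = (x : ℍ) := by
  simp [emb, slicePoint]

/-- `ofQ` as a continuous real-linear map. -/
noncomputable def ofQL : ℍ →L[ℝ] (Fin 4 → ℂ) :=
  LinearMap.toContinuousLinearMap
    { toFun := ofQ
      map_add' := fun a b => by funext j; fin_cases j <;> simp
      map_smul' := fun r a => by funext j; fin_cases j <;> simp }

theorem ofQL_apply (a : ℍ) : ofQL a = ofQ a := rfl

theorem continuous_reQ : Continuous reQ :=
  (LinearMap.toContinuousLinearMap (𝕜 := ℝ) (E := Fin 4 → ℂ) (F' := ℍ)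
    { toFun := reQ
      map_add' := fun X Y => by ext <;> simp
      map_smul' := fun r X => by ext <;> simp }).continuous

theorem continuous_imQ : Continuous imQ :=
  (LinearMap.toContinuousLinearMap (𝕜 := ℝ) (E := Fin 4 → ℂ) (F' := ℍ)
    { toFun := imQ
      map_add' := fun X Y => by ext <;> simp
      map_smul' := fun r X => by ext <;> simp }).continuous

/-- The Cauchy–Riemann equation on the slice `ℂ_I` in terms of the real Fréchet derivative. -/
theorem exists_hasFDerivAt_slice {f : ℍ → ℍ} (hf : IsSliceRegularOn f (ball 0 1)) {I : ℍ}
    (hI : I ∈ imagSphere) {z : ℂ} (hz : z ∈ ball (0 : ℂ) 1) :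
    ∃ D : ℂ →L[ℝ] ℍ, HasFDerivAt (fun z : ℂ => f (emb I z)) D z ∧ D Complex.I = I * D 1 := by
  obtain ⟨hC, hCR⟩ := hf I hI
  have hopen : IsOpen {p : ℝ × ℝ | slicePoint I p.1 p.2 ∈ ball (0 : ℍ) 1} := by
    have : {p : ℝ × ℝ | slicePoint I p.1 p.2 ∈ ball (0 : ℍ) 1} =
        Complex.equivRealProdCLM.symm ⁻¹' ball (0 : ℂ) 1 := by
      ext p
      exact emb_mem_ball (z := Complex.equivRealProdCLM.symm p) hI
    rw [this]
    exact isOpen_ball.preimage Complex.equivRealProdCLM.symm.continuous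
  have hmem : (z.re, z.im) ∈ {p : ℝ × ℝ | slicePoint I p.1 p.2 ∈ ball (0 : ℍ) 1} :=
    (emb_mem_ball hI).2 hz
  have hd := ((hC.differentiableOn one_ne_zero).differentiableAt (hopen.mem_nhds hmem)).hasFDerivAt
  set g' := fderiv ℝ (fun p : ℝ × ℝ => f (slicePoint I p.1 p.2)) (z.re, z.im) with hg'
  refine ⟨g'.comp (Complex.equivRealProdCLM : ℂ →L[ℝ] ℝ × ℝ), ?_, ?_⟩
  · exact HasFDerivAt.comp z (g := fun p : ℝ × ℝ => f (slicePoint I p.1 p.2)) hd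
      Complex.equivRealProdCLM.hasFDerivAt
  · have hx : partialX f I z.re z.im = g' (1, 0) := by
      have h1 : HasDerivAt (fun s : ℝ => (s, z.im)) (1, 0) z.re :=
        (hasDerivAt_id _).prodMk (hasDerivAt_const _ _)
      exact (HasFDerivAt.comp_hasDerivAt z.re (f := fun s : ℝ => (s, z.im)) hd h1).deriv
    have hy : partialY f I z.re z.im = g' (0, 1) := by
      have h1 : HasDerivAt (fun t : ℝ => (z.re, t)) (0, 1) z.im :=
        (hasDerivAt_const _ _).prodMk (hasDerivAt_id _)
      exact (HasFDerivAt.comp_hasDerivAt z.im (f := fun t : ℝ => (z.re, t)) hd h1).deriv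
    have h2 := hCR z.re z.im hmem
    have h3 : partialX f I z.re z.im + I * partialY f I z.re z.im = 0 :=
      (smul_eq_zero.1 h2).resolve_left (by norm_num)
    rw [hx, hy] at h3
    have h4 : g' (1, 0) = -(I * g' (0, 1)) := eq_neg_of_add_eq_zero_left h3
    change g' (Complex.equivRealProdCLM Complex.I) = I * g' (Complex.equivRealProdCLM 1)
    have e1 : Complex.equivRealProdCLM Complex.I = (0, 1) := by simp
    have e2 : Complex.equivRealProdCLM 1 = (1, 0) := by simp
    rw [e1, e2, h4, mul_neg, ← mul_assoc, imagSphere_mul_self hI]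
    simp

/-- The stem reconstructed from the slice `ℂ_I`. -/
noncomputable def stemOf (f : ℍ → ℍ) (I : ℍ) (z : ℂ) : Fin 4 → ℂ :=
  ofQL ((1 / 2 : ℝ) • (f (emb I z) + f (emb I (conj z)))) +
    Complex.I • ofQL (-((1 / 2 : ℝ) • (I * (f (emb I z) - f (emb I (conj z))))))

theorem ev_stemOf {I : ℍ} (hI : I ∈ imagSphere) (f : ℍ → ℍ) (z : ℂ) :
    ev I (stemOf f I z) = f (emb I z) := by
  rw [stemOf, ev_add, ev_smul hI, ofQL_apply, ofQL_apply, ev_ofQ, ev_ofQ]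
  have : emb I Complex.I = I := by simp [emb, slicePoint]
  rw [this, mul_neg, mul_smul_comm, ← mul_assoc, imagSphere_mul_self hI, neg_one_mul, smul_neg,
    neg_neg, ← smul_add]
  have : f (emb I z) + f (emb I (conj z)) + (f (emb I z) - f (emb I (conj z))) =
    (2 : ℝ) • f (emb I z) := by rw [two_smul]; abel
  rw [this, smul_smul]
  norm_num

theorem stemOf_ofReal (f : ℍ → ℍ) (I : ℍ) (x : ℝ) :
    stemOf f I (x : ℂ) = ofQ (f (x : ℍ)) := by
  rw [stemOf, Complex.conj_ofReal, emb_ofReal, sub_self, mul_zero, smul_zero, neg_zero, map_zero,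
    smul_zero, add_zero, ← two_smul ℝ, smul_smul, ofQL_apply]
  norm_num

theorem differentiableOn_stemOf {f : ℍ → ℍ} (hf : IsSliceRegularOn f (ball 0 1)) {I : ℍ}
    (hI : I ∈ imagSphere) : DifferentiableOn ℂ (stemOf f I) (ball 0 1) := by
  intro z hz
  obtain ⟨D, hD, hDI⟩ := exists_hasFDerivAt_slice hf hI hz
  obtain ⟨E, hE, hEI⟩ := exists_hasFDerivAt_slice hf hI (z := conj z) (by simpa using hz)
  have hconj : HasFDerivAt (fun z : ℂ => conj z) (Complex.conjCLE : ℂ →L[ℝ] ℂ) z :=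
    Complex.conjCLE.hasFDerivAt
  have hE2 : HasFDerivAt (fun z : ℂ => f (emb I (conj z)))
      (E.comp (Complex.conjCLE : ℂ →L[ℝ] ℂ)) z := HasFDerivAt.comp z hE hconj
  have h1 := ofQL.hasFDerivAt.comp z ((hD.add hE2).const_smul (1 / 2 : ℝ))
  have h2 := ofQL.hasFDerivAt.comp z ((((hD.sub hE2).const_mul I).const_smul (1 / 2 : ℝ)).neg)
  have h3 := h1.add (h2.const_smul Complex.I)
  have h4 : HasFDerivAt (stemOf f I) _ z := h3
  refine (differentiableAt_complex_iff_differentiableAt_real.2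
    ⟨h4.differentiableAt, ?_⟩).differentiableWithinAt
  rw [h4.fderiv]
  have key : ∀ a b : ℍ, ofQL ((1 / 2 : ℝ) • (I * a + -(I * b))) +
      Complex.I • ofQL (-((1 / 2 : ℝ) • (I * (I * a - -(I * b))))) =
      Complex.I • (ofQL ((1 / 2 : ℝ) • (a + b)) +
        Complex.I • ofQL (-((1 / 2 : ℝ) • (I * (a - b))))) := by
    intro a b
    have e2 : I * (I * a - -(I * b)) = -(a + b) := by
      rw [sub_neg_eq_add, ← mul_add, ← mul_assoc, imagSphere_mul_self hI, neg_one_mul]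
    have e3 : I * a + -(I * b) = I * (a - b) := by rw [mul_sub]; abel
    rw [e2, e3, smul_add Complex.I, smul_smul Complex.I Complex.I, Complex.I_mul_I]
    simp only [map_neg, neg_smul, one_smul, neg_neg, smul_neg]
    exact add_comm _ _
  simpa [hDI, hEI] using key (D 1) (E 1)

/-- A slice regular function on the ball has a holomorphic stem: the stems reconstructed from two
slices agree on the real axis, hence everywhere. -/
theorem exists_isStem {f : ℍ → ℍ} (hf : IsSliceRegularOn f (ball 0 1)) : ∃ A, IsStem f A := by
  refine ⟨stemOf f quatI, differentiableOn_stemOf hf quatI_mem, fun I hI z hz => ?_⟩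
  have h1 : AnalyticOnNhd ℂ (stemOf f I) (ball 0 1) :=
    (differentiableOn_stemOf hf hI).analyticOnNhd isOpen_ball
  have h2 : AnalyticOnNhd ℂ (stemOf f quatI) (ball 0 1) :=
    (differentiableOn_stemOf hf quatI_mem).analyticOnNhd isOpen_ball
  have h3 : EqOn (stemOf f I) (stemOf f quatI) (ball 0 1) := by
    refine h1.eqOn_of_preconnected_of_frequently_eq h2 (convex_ball 0 1).isPreconnected
      (mem_ball_self one_pos) ?_
    have h4 : Tendsto (fun x : ℝ => (x : ℂ)) (𝓝[≠] 0) (𝓝[≠] 0) := by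
      refine tendsto_nhdsWithin_iff.2 ⟨?_, ?_⟩
      · have : Tendsto (fun x : ℝ => (x : ℂ)) (𝓝 0) (𝓝 ((0 : ℝ) : ℂ)) :=
          Complex.continuous_ofReal.tendsto _
        rw [Complex.ofReal_zero] at this
        exact this.mono_left nhdsWithin_le_nhds
      · filter_upwards [self_mem_nhdsWithin] with x hx
        simpa using hx
    refine h4.frequently (Eventually.frequently (Eventually.of_forall fun x => ?_))
    rw [stemOf_ofReal, stemOf_ofReal]
  rw [← h3 hz, ev_stemOf hI]

theorem IsStem.apply_eq {f : ℍ → ℍ} {A : ℂ → Fin 4 → ℂ} (h : IsStem f A) {q : ℍ}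
    (hq : q ∈ ball (0 : ℍ) 1) : f q = ev (imagUnit q) (A (toC q)) := by
  have := h.eq _ (imagUnit_mem q) _ (toC_mem_ball.2 hq)
  rwa [emb_toC] at this

theorem IsStem.hasDerivAt {f : ℍ → ℍ} {A : ℂ → Fin 4 → ℂ} (h : IsStem f A) {z : ℂ}
    (hz : z ∈ ball (0 : ℂ) 1) : HasDerivAt A (deriv A z) z :=
  (h.diff.differentiableAt (isOpen_ball.mem_nhds hz)).hasDerivAt

/-- The slice derivative has the derivative of the stem as its stem. -/
theorem IsStem.sliceDeriv_eq {f : ℍ → ℍ} {A : ℂ → Fin 4 → ℂ} (h : IsStem f A)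
    (hf : IsSliceRegularOn f (ball 0 1)) {I : ℍ} (hI : I ∈ imagSphere) {z : ℂ}
    (hz : z ∈ ball (0 : ℂ) 1) : sliceDeriv f (emb I z) = ev I (deriv A z) := by
  have hd := h.hasDerivAt hz
  -- Derivatives of `f` along curves in the slice.
  have key : ∀ (c : ℝ → ℂ) (c' : ℂ) (t : ℝ), c t = z → HasDerivAt c c' t →
      HasDerivAt (fun s => f (emb I (c s))) (ev I (c' • deriv A z)) t := by
    intro c c' t hc hcd
    have h1 : HasDerivAt (fun s => A (c s)) (c' • deriv A z) t :=
      HasDerivAt.scomp t (by rw [hc]; exact hd) hcd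
    have h2 := (evL I).hasFDerivAt.comp_hasDerivAt t h1
    refine h2.congr_of_eventuallyEq ?_
    have h3 : ∀ᶠ s in 𝓝 t, c s ∈ ball (0 : ℂ) 1 :=
      hcd.continuousAt.eventually_mem (isOpen_ball.mem_nhds (by rw [hc]; exact hz))
    filter_upwards [h3] with s hs
    exact h.eq I hI _ hs
  have hx : partialX f I z.re z.im = ev I (deriv A z) := by
    have h1 : HasDerivAt (fun s : ℝ => (⟨s, z.im⟩ : ℂ)) 1 z.re := by
      have h2 : HasDerivAt (fun s : ℝ => (s : ℂ) + z.im * Complex.I) 1 z.re := by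
        simpa using ((hasDerivAt_id (z.re : ℂ)).comp_ofReal).add_const (z.im * Complex.I)
      refine h2.congr_of_eventuallyEq (Eventually.of_forall fun s => ?_)
      exact Complex.mk_eq_add_mul_I s z.im
    have h3 := key _ _ z.re rfl h1
    rw [one_smul] at h3
    exact h3.deriv
  have hy : partialY f I z.re z.im = ev I (Complex.I • deriv A z) := by
    have h1 : HasDerivAt (fun t : ℝ => (⟨z.re, t⟩ : ℂ)) Complex.I z.im := by
      have h2 : HasDerivAt (fun t : ℝ => (z.re : ℂ) + t * Complex.I) Complex.I z.im := by
        simpa using (((hasDerivAt_id (z.im : ℂ)).comp_ofReal).mul_const Complex.I).const_add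
          (z.re : ℂ)
      refine h2.congr_of_eventuallyEq (Eventually.of_forall fun t => ?_)
      exact Complex.mk_eq_add_mul_I z.re t
    exact (key _ _ z.im rfl h1).deriv
  rw [sliceDeriv_slicePoint hf hI ((emb_mem_ball hI).2 hz), derivAlong, hx, hy, ev_smul hI]
  have : emb I Complex.I = I := by simp [emb, slicePoint]
  rw [this, ← mul_assoc, imagSphere_mul_self hI, neg_one_mul, sub_neg_eq_add, ← two_smul ℝ,
    smul_smul]
  norm_num

theorem IsStem.imQ_ofReal {f : ℍ → ℍ} {A : ℂ → Fin 4 → ℂ} (h : IsStem f A) {x : ℝ}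
    (hx : (x : ℂ) ∈ ball (0 : ℂ) 1) : imQ (A x) = 0 := by
  have h1 := h.eq _ quatI_mem _ hx
  have h2 := h.eq _ (neg_mem_imagSphere quatI_mem) _ hx
  rw [emb_ofReal] at h1 h2
  rw [h1] at h2
  have h3 : (quatI - -quatI) * imQ (A x) = 0 := by
    rw [ev, ev] at h2
    have := add_left_cancel h2
    rw [sub_mul, this, sub_self]
  exact (mul_eq_zero.1 h3).resolve_left (sub_ne_zero.2 (imagSphere_ne_neg quatI_mem))

theorem continuous_im : Continuous (fun q : ℍ => q.im) :=
  Quaternion.continuous_im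

theorem continuous_toC : Continuous toC := by
  have h : toC = fun q => (q.re : ℂ) + (‖q.im‖ : ℂ) * Complex.I := by
    funext q
    exact Complex.mk_eq_add_mul_I _ _
  rw [h]
  have h1 : Continuous fun q : ℍ => q.re := Quaternion.continuous_re
  have h2 : Continuous fun q : ℍ => ‖q.im‖ := continuous_im.norm
  fun_prop

/-- A function with a holomorphic stem is continuous. At a real point, where `imagUnit` is
discontinuous, the imaginary part of the stem vanishes. -/
theorem IsStem.continuousOn {f : ℍ → ℍ} {A : ℂ → Fin 4 → ℂ} (h : IsStem f A) :
    ContinuousOn f (ball 0 1) := by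
  intro q hq
  refine ContinuousAt.continuousWithinAt ?_
  have hA : ContinuousAt (fun p => A (toC p)) q :=
    ContinuousAt.comp (g := A)
      (h.diff.continuousOn.continuousAt (isOpen_ball.mem_nhds (toC_mem_ball.2 hq)))
      continuous_toC.continuousAt
  have hre : ContinuousAt (fun p => reQ (A (toC p))) q := continuous_reQ.continuousAt.comp hA
  have him : ContinuousAt (fun p => imQ (A (toC p))) q := continuous_imQ.continuousAt.comp hA
  have hev : f =ᶠ[𝓝 q] fun p => reQ (A (toC p)) + imagUnit p * imQ (A (toC p)) := by
    filter_upwards [isOpen_ball.mem_nhds hq] with p hp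
    exact h.apply_eq hp
  refine ContinuousAt.congr (f := fun p => reQ (A (toC p)) + imagUnit p * imQ (A (toC p))) ?_
    hev.symm
  by_cases h0 : q.im = 0
  · refine hre.add ?_
    have hz : imQ (A (toC q)) = 0 := by
      have e : toC q = (q.re : ℂ) := by
        apply Complex.ext <;> simp [toC, h0]
      have hq2 := toC_mem_ball.2 hq
      rw [e] at hq2 ⊢
      exact h.imQ_ofReal hq2
    have h1 : Tendsto (fun p => imQ (A (toC p))) (𝓝 q) (𝓝 0) := by
      rw [← hz]; exact him
    rw [ContinuousAt, hz, mul_zero, tendsto_zero_iff_norm_tendsto_zero]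
    refine (tendsto_zero_iff_norm_tendsto_zero.1 h1).congr fun p => ?_
    rw [norm_mul, (imagSphere_re (imagUnit_mem p)).2, one_mul]
  · refine hre.add (ContinuousAt.mul ?_ him)
    have h1 : ∀ᶠ p in 𝓝 q, p.im ≠ 0 :=
      continuous_im.continuousAt.eventually_ne h0
    have h2 : imagUnit =ᶠ[𝓝 q] fun p => (‖p.im‖⁻¹ : ℝ) • p.im := by
      filter_upwards [h1] with p hp
      rw [imagUnit, if_neg hp, Quaternion.coe_mul_eq_smul]
    refine ContinuousAt.congr ?_ h2.symm
    exact (continuous_im.continuousAt.norm.inv₀ (norm_ne_zero_iff.2 h0)).smul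
      continuous_im.continuousAt

/-! ### Covering and injectivity through scalar functions -/

theorem IsStem.apply_zero {f : ℍ → ℍ} {A : ℂ → Fin 4 → ℂ} (h : IsStem f A) (h0 : f 0 = 0) :
    A 0 = 0 := by
  have h1 : ∀ I ∈ imagSphere, ev I (A 0) = 0 := by
    intro I hI
    rw [← h.eq I hI 0 (mem_ball_self one_pos)]
    simpa [emb, slicePoint] using h0
  exact eq_zero_of_ev_eq_zero (imagSphere_ne_neg quatI_mem) (h1 _ quatI_mem)
    (h1 _ (neg_mem_imagSphere quatI_mem))

/-- The scalar function of `z` whose zeros are the spheres on which `f` takes the value `w`. -/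
noncomputable def valueForm (A : ℂ → Fin 4 → ℂ) (w : ℍ) (z : ℂ) : ℂ :=
  nsq (A z) - 2 * dotQ (A z) w + (‖w‖ : ℂ) ^ 2

/-- The denominator that makes `M² valueForm A w / dualForm A w M` the product of the two scalar
Möbius transforms of the eigenvalues of `A z`. -/
noncomputable def dualForm (A : ℂ → Fin 4 → ℂ) (w : ℍ) (M : ℝ) (z : ℂ) : ℂ :=
  (M : ℂ) ^ 4 - (M : ℂ) ^ 2 * (2 * dotQ (A z) w) + (‖w‖ : ℂ) ^ 2 * nsq (A z)

theorem valueForm_eq (A : ℂ → Fin 4 → ℂ) (w : ℍ) (z : ℂ) :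
    valueForm A w z = nsq (A z - ofQ w) := (nsq_sub_ofQ _ _).symm

theorem valueForm_eq_zero {A : ℂ → Fin 4 → ℂ} {w I : ℍ} {z : ℂ} (hI : I ∈ imagSphere)
    (h : ev I (A z) = w) : valueForm A w z = 0 := by
  rw [valueForm_eq, nsq_eq_zero_iff]
  exact ⟨I, hI, by rw [ev_sub, ev_ofQ, h, sub_self]⟩

theorem valueForm_of_zero {A : ℂ → Fin 4 → ℂ} {z : ℂ} (h : A z = 0) (w : ℍ) :
    valueForm A w z = (‖w‖ : ℂ) ^ 2 := by
  simp [valueForm, h, nsq, dotQ]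

theorem dualForm_of_zero {A : ℂ → Fin 4 → ℂ} {z : ℂ} (h : A z = 0) (w : ℍ) (M : ℝ) :
    dualForm A w M z = (M : ℂ) ^ 4 := by
  simp [dualForm, h, nsq, dotQ]

theorem IsStem.differentiableOn_apply {f : ℍ → ℍ} {A : ℂ → Fin 4 → ℂ} (h : IsStem f A)
    (j : Fin 4) : DifferentiableOn ℂ (fun z => A z j) (ball 0 1) :=
  differentiableOn_pi.1 h.diff j

theorem IsStem.differentiableOn_valueForm {f : ℍ → ℍ} {A : ℂ → Fin 4 → ℂ} (h : IsStem f A)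
    (w : ℍ) : DifferentiableOn ℂ (valueForm A w) (ball 0 1) := by
  have h0 := h.differentiableOn_apply 0
  have h1 := h.differentiableOn_apply 1
  have h2 := h.differentiableOn_apply 2
  have h3 := h.differentiableOn_apply 3
  unfold valueForm nsq dotQ
  fun_prop

theorem IsStem.differentiableOn_dualForm {f : ℍ → ℍ} {A : ℂ → Fin 4 → ℂ} (h : IsStem f A)
    (w : ℍ) (M : ℝ) : DifferentiableOn ℂ (dualForm A w M) (ball 0 1) := by
  have h0 := h.differentiableOn_apply 0
  have h1 := h.differentiableOn_apply 1
  have h2 := h.differentiableOn_apply 2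
  have h3 := h.differentiableOn_apply 3
  unfold dualForm nsq dotQ
  fun_prop

theorem IsStem.eigenvalues {f : ℍ → ℍ} {A : ℂ → Fin 4 → ℂ} (h : IsStem f A) {w : ℍ}
    (hw : w ≠ 0) {z : ℂ} (hz : z ∈ ball (0 : ℂ) 1) :
    ∃ l₁ l₂ : ℂ, (∃ q, ‖q‖ = ‖z‖ ∧ ‖f q‖ = ‖l₁‖) ∧ (∃ q, ‖q‖ = ‖z‖ ∧ ‖f q‖ = ‖l₂‖) ∧
      valueForm A w z = (l₁ - ‖w‖) * (l₂ - ‖w‖) ∧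
      ∀ M : ℝ, dualForm A w M z = ((M : ℂ) ^ 2 - ‖w‖ * l₁) * ((M : ℂ) ^ 2 - ‖w‖ * l₂) := by
  obtain ⟨l₁, l₂, ⟨I, hI, h1⟩, ⟨K, hK, h2⟩, h3, h4⟩ := exists_eigenvalues (A z) hw
  refine ⟨l₁, l₂, ⟨emb I z, norm_emb hI z, ?_⟩, ⟨emb K z, norm_emb hK z, ?_⟩, h3,
    fun M => h4 M⟩
  · rw [h.eq I hI z hz, h1]
  · rw [h.eq K hK z hz, h2]

/-- If `|f| ≥ R` on the sphere of radius `ρ`, then the image of the ball of radius `ρ` contains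
the ball of radius `R`: were `w` omitted, the quotient `dualForm / (R² valueForm)` would be
holomorphic, bounded by one on the circle, and equal to `R² / |w|² > 1` at the origin. -/
theorem IsStem.ball_subset_image {f : ℍ → ℍ} {A : ℂ → Fin 4 → ℂ} (h : IsStem f A)
    (h0 : f 0 = 0) {ρ R : ℝ} (hρ : 0 < ρ) (hρ1 : ρ < 1) (hR : ∀ q : ℍ, ‖q‖ = ρ → R ≤ ‖f q‖) :
    ball (0 : ℍ) R ⊆ f '' ball (0 : ℍ) ρ := by
  intro w hw
  have hwR : ‖w‖ < R := by simpa using hw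
  by_cases hw0 : w = 0
  · exact ⟨0, mem_ball_self hρ, by rw [h0, hw0]⟩
  have hwp : 0 < ‖w‖ := norm_pos_iff.2 hw0
  have hRp : 0 < R := hwp.trans hwR
  by_contra hno
  have hsub : closedBall (0 : ℂ) ρ ⊆ ball (0 : ℂ) 1 := closedBall_subset_ball hρ1
  have hne : ∀ z ∈ closedBall (0 : ℂ) ρ, valueForm A w z ≠ 0 := by
    intro z hz hzero
    rw [valueForm_eq, nsq_eq_zero_iff] at hzero
    obtain ⟨I, hI, h1⟩ := hzero
    rw [ev_sub, ev_ofQ, ← h.eq I hI z (hsub hz), sub_eq_zero] at h1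
    have h2 : ‖emb I z‖ ≤ ρ := by rw [norm_emb hI]; simpa using hz
    rcases h2.lt_or_eq with h3 | h3
    · exact hno ⟨emb I z, by simpa using h3, h1⟩
    · have := hR _ h3
      rw [h1] at this
      linarith
  set G : ℂ → ℂ := fun z => dualForm A w R z / ((R : ℂ) ^ 2 * valueForm A w z) with hG
  have hRc : (R : ℂ) ^ 2 ≠ 0 := pow_ne_zero 2 (by exact_mod_cast hRp.ne')
  have hGd : DiffContOnCl ℂ G (ball 0 ρ) := by
    apply DifferentiableOn.diffContOnCl
    rw [closure_ball _ hρ.ne']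
    exact ((h.differentiableOn_dualForm w R).mono hsub).div
      (((h.differentiableOn_valueForm w).mono hsub).const_mul _)
      (fun z hz => mul_ne_zero hRc (hne z hz))
  have hfac : ∀ l : ℂ, R ≤ ‖l‖ → ‖(R : ℂ) ^ 2 - ‖w‖ * l‖ ≤ R * ‖l - ‖w‖‖ := by
    intro l hl
    have h1 := normSq_moebius R ‖w‖ l
    have h2 : ‖(R : ℂ) * (l - ‖w‖)‖ = R * ‖l - ‖w‖‖ := by
      rw [norm_mul, Complex.norm_real, Real.norm_of_nonneg hRp.le]
    rw [h2] at h1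
    have h3 : 0 ≤ (R ^ 2 - ‖w‖ ^ 2) * (‖l‖ ^ 2 - R ^ 2) := by
      apply mul_nonneg <;> nlinarith
    exact le_of_sq_le_sq (by linarith) (by positivity)
  have hbd : ∀ z ∈ frontier (ball (0 : ℂ) ρ), ‖G z‖ ≤ 1 := by
    intro z hz
    rw [frontier_ball _ hρ.ne'] at hz
    have hzc : z ∈ closedBall (0 : ℂ) ρ := sphere_subset_closedBall hz
    have hzn : ‖z‖ = ρ := by simpa using hz
    obtain ⟨l₁, l₂, ⟨q₁, hq₁, e1⟩, ⟨q₂, hq₂, e2⟩, h3, h4⟩ := h.eigenvalues hw0 (hsub hzc)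
    have hl1 := hfac l₁ (by rw [← e1]; exact hR _ (hq₁.trans hzn))
    have hl2 := hfac l₂ (by rw [← e2]; exact hR _ (hq₂.trans hzn))
    have hpos : 0 < ‖(R : ℂ) ^ 2 * valueForm A w z‖ :=
      norm_pos_iff.2 (mul_ne_zero hRc (hne z hzc))
    rw [hG]
    simp only
    rw [norm_div, div_le_one hpos, h4, h3, norm_mul, norm_mul, norm_mul, norm_pow,
      Complex.norm_real, Real.norm_of_nonneg hRp.le]
    calc _ ≤ (R * ‖l₁ - ‖w‖‖) * (R * ‖l₂ - ‖w‖‖) := by gcongr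
      _ = _ := by ring
  have hfin := Complex.norm_le_of_forall_mem_frontier_norm_le isBounded_ball hGd hbd
    (subset_closure (mem_ball_self hρ))
  have hA := h.apply_zero h0
  have hG0 : G 0 = ((R ^ 2 / ‖w‖ ^ 2 : ℝ) : ℂ) := by
    rw [hG]
    simp only
    rw [valueForm_of_zero hA, dualForm_of_zero hA]
    push_cast
    field_simp
  rw [hG0, Complex.norm_real, Real.norm_of_nonneg (by positivity),
    div_le_one (by positivity)] at hfin
  nlinarith

theorem two_le_analyticOrderAt_nsq {X : ℂ → Fin 4 → ℂ} {b : ℂ}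
    (hX : ∀ j, AnalyticAt ℂ (fun z => X z j) b) (h0 : X b = 0) :
    2 ≤ analyticOrderAt (fun z => nsq (X z)) b := by
  have hA : AnalyticAt ℂ (fun z => nsq (X z)) b := by
    have a0 := hX 0
    have a1 := hX 1
    have a2 := hX 2
    have a3 := hX 3
    unfold nsq
    fun_prop
  refine (natCast_le_analyticOrderAt_iff_iteratedDeriv_eq_zero (n := 2) hA).2 fun i hi => ?_
  have hd := fun j => (hX j).differentiableAt.hasDerivAt.pow 2
  have hs := (((hd 0).add (hd 1)).add (hd 2)).add (hd 3)
  interval_cases i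
  · simp [h0, nsq]
  · rw [iteratedDeriv_one]
    refine (HasDerivAt.deriv hs).trans ?_
    simp [h0]

/-- The order of vanishing of the form of the value `w = f(p) = f(q)`: the points of the two
spheres of `p ≠ q` are zeros, with multiplicity two where two of them coincide, because then two
different evaluations of the stem agree. -/
theorem IsStem.count_le_analyticOrderAt {f : ℍ → ℍ} {A : ℂ → Fin 4 → ℂ} (h : IsStem f A)
    {I K : ℍ} (hI : I ∈ imagSphere) (hK : K ∈ imagSphere) {z₁ z₂ : ℂ}
    (hz₁ : z₁ ∈ ball (0 : ℂ) 1) (hz₂ : z₂ ∈ ball (0 : ℂ) 1) (hne : emb I z₁ ≠ emb K z₂) {w : ℍ}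
    (hp : f (emb I z₁) = w) (hq : f (emb K z₂) = w) {b : ℂ} (hb : b ∈ ball (0 : ℂ) 1) :
    (Multiset.count b (z₁ ::ₘ conj z₁ ::ₘ z₂ ::ₘ conj z₂ ::ₘ 0) : ℕ∞) ≤
      analyticOrderAt (valueForm A w) b := by
  have hI' := neg_mem_imagSphere hI
  have hK' := neg_mem_imagSphere hK
  have e1 : b = z₁ → ev I (A b) = w ∧ emb I b = emb I z₁ := by
    rintro rfl
    exact ⟨by rw [← h.eq I hI b hb, hp], rfl⟩
  have e2 : b = conj z₁ → ev (-I) (A b) = w ∧ emb (-I) b = emb I z₁ := by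
    rintro rfl
    exact ⟨by rw [← h.eq _ hI' _ hb, emb_conj, hp], emb_conj _ _⟩
  have e3 : b = z₂ → ev K (A b) = w ∧ emb K b = emb K z₂ := by
    rintro rfl
    exact ⟨by rw [← h.eq K hK b hb, hq], rfl⟩
  have e4 : b = conj z₂ → ev (-K) (A b) = w ∧ emb (-K) b = emb K z₂ := by
    rintro rfl
    exact ⟨by rw [← h.eq _ hK' _ hb, emb_conj, hq], emb_conj _ _⟩
  have hone : valueForm A w b = 0 → 1 ≤ analyticOrderAt (valueForm A w) b := by
    intro h1
    rw [Order.one_le_iff_ne_zero, analyticOrderAt_ne_zero]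
    exact ⟨(h.differentiableOn_valueForm w).analyticAt (isOpen_ball.mem_nhds hb), h1⟩
  have htwo : ∀ S T : ℍ, S ≠ T → ev S (A b) = w → ev T (A b) = w →
      2 ≤ analyticOrderAt (valueForm A w) b := by
    intro S T hST hS hT
    have h1 : A b - ofQ w = 0 := eq_zero_of_ev_eq_zero hST
      (by rw [ev_sub, ev_ofQ, hS, sub_self]) (by rw [ev_sub, ev_ofQ, hT, sub_self])
    have h2 : valueForm A w = fun z => nsq (A z - ofQ w) := funext fun z => valueForm_eq A w z
    rw [h2]
    refine two_le_analyticOrderAt_nsq (X := fun z => A z - ofQ w) (fun j => ?_) h1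
    exact ((h.differentiableOn_apply j).analyticAt (isOpen_ball.mem_nhds hb)).sub analyticAt_const
  have hreal : b = z₁ → b = conj z₁ → (b = z₂ ∨ b = conj z₂) → False := by
    intro a1 a2 a3
    have him : b.im = 0 := by
      have := congrArg Complex.im a2
      rw [← a1, Complex.conj_im] at this
      linarith
    have he : ∀ S T : ℍ, emb S b = emb T b := fun S T => by simp [emb, slicePoint, him]
    rcases a3 with a3 | a3
    · exact hne (by rw [← (e1 a1).2, ← (e3 a3).2]; exact he _ _)
    · exact hne (by rw [← (e1 a1).2, ← (e4 a3).2]; exact he _ _)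
  have hreal' : b = z₂ → b = conj z₂ → (b = z₁ ∨ b = conj z₁) → False := by
    intro a1 a2 a3
    have him : b.im = 0 := by
      have := congrArg Complex.im a2
      rw [← a1, Complex.conj_im] at this
      linarith
    have he : ∀ S T : ℍ, emb S b = emb T b := fun S T => by simp [emb, slicePoint, him]
    rcases a3 with a3 | a3
    · exact hne (by rw [← (e1 a3).2, ← (e3 a1).2]; exact he _ _)
    · exact hne (by rw [← (e2 a3).2, ← (e3 a1).2]; exact he _ _)
  have t12 : b = z₁ → b = conj z₁ → 2 ≤ analyticOrderAt (valueForm A w) b := fun a1 a2 =>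
    htwo _ _ (imagSphere_ne_neg hI) (e1 a1).1 (e2 a2).1
  have t34 : b = z₂ → b = conj z₂ → 2 ≤ analyticOrderAt (valueForm A w) b := fun a1 a2 =>
    htwo _ _ (imagSphere_ne_neg hK) (e3 a1).1 (e4 a2).1
  have t13 : b = z₁ → b = z₂ → 2 ≤ analyticOrderAt (valueForm A w) b := fun a1 a2 =>
    htwo _ _ (fun hST => hne (by rw [← (e1 a1).2, ← (e3 a2).2, hST])) (e1 a1).1 (e3 a2).1
  have t14 : b = z₁ → b = conj z₂ → 2 ≤ analyticOrderAt (valueForm A w) b := fun a1 a2 =>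
    htwo _ _ (fun hST => hne (by rw [← (e1 a1).2, ← (e4 a2).2, hST])) (e1 a1).1 (e4 a2).1
  have t23 : b = conj z₁ → b = z₂ → 2 ≤ analyticOrderAt (valueForm A w) b := fun a1 a2 =>
    htwo _ _ (fun hST => hne (by rw [← (e2 a1).2, ← (e3 a2).2, hST])) (e2 a1).1 (e3 a2).1
  have t24 : b = conj z₁ → b = conj z₂ → 2 ≤ analyticOrderAt (valueForm A w) b := fun a1 a2 =>
    htwo _ _ (fun hST => hne (by rw [← (e2 a1).2, ← (e4 a2).2, hST])) (e2 a1).1 (e4 a2).1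
  have o1 : b = z₁ → 1 ≤ analyticOrderAt (valueForm A w) b := fun a =>
    hone (valueForm_eq_zero hI (e1 a).1)
  have o2 : b = conj z₁ → 1 ≤ analyticOrderAt (valueForm A w) b := fun a =>
    hone (valueForm_eq_zero hI' (e2 a).1)
  have o3 : b = z₂ → 1 ≤ analyticOrderAt (valueForm A w) b := fun a =>
    hone (valueForm_eq_zero hK (e3 a).1)
  have o4 : b = conj z₂ → 1 ≤ analyticOrderAt (valueForm A w) b := fun a =>
    hone (valueForm_eq_zero hK' (e4 a).1)
  clear e1 e2 e3 e4 hone htwo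
  generalize analyticOrderAt (valueForm A w) b = n at *
  simp only [Multiset.count_cons, Multiset.count_zero]
  split_ifs <;>
    first
    | exact (hreal ‹_› ‹_› (Or.inl ‹_›)).elim
    | exact (hreal ‹_› ‹_› (Or.inr ‹_›)).elim
    | exact (hreal' ‹_› ‹_› (Or.inl ‹_›)).elim
    | exact (hreal' ‹_› ‹_› (Or.inr ‹_›)).elim
    | exact le_trans (by norm_num) (t12 ‹_› ‹_›)
    | exact le_trans (by norm_num) (t13 ‹_› ‹_›)
    | exact le_trans (by norm_num) (t14 ‹_› ‹_›)
    | exact le_trans (by norm_num) (t23 ‹_› ‹_›)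
    | exact le_trans (by norm_num) (t24 ‹_› ‹_›)
    | exact le_trans (by norm_num) (t34 ‹_› ‹_›)
    | exact le_trans (by norm_num) (o1 ‹_›)
    | exact le_trans (by norm_num) (o2 ‹_›)
    | exact le_trans (by norm_num) (o3 ‹_›)
    | exact le_trans (by norm_num) (o4 ‹_›)
    | simp

/-- A value taken at two different points of the ball by a function bounded by `M` is at most
`M` times the product of the moduli of the points. -/
theorem IsStem.norm_le_mul_mul {f : ℍ → ℍ} {A : ℂ → Fin 4 → ℂ} (h : IsStem f A) (h0 : f 0 = 0)
    {M : ℝ} (hM : ∀ q ∈ ball (0 : ℍ) 1, ‖f q‖ < M) {p q : ℍ} (hp : p ∈ ball (0 : ℍ) 1)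
    (hq : q ∈ ball (0 : ℍ) 1) (hne : p ≠ q) (hpq : f p = f q) : ‖f p‖ ≤ M * ‖p‖ * ‖q‖ := by
  have hMp : 0 < M := (norm_nonneg _).trans_lt (hM p hp)
  set w := f p with hw
  by_cases hw0 : w = 0
  · rw [hw0, norm_zero]; positivity
  have hwp : 0 < ‖w‖ := norm_pos_iff.2 hw0
  have hwM : ‖w‖ < M := hM p hp
  have hMc : (M : ℂ) ^ 2 ≠ 0 := pow_ne_zero 2 (by exact_mod_cast hMp.ne')
  have hlM : ∀ z ∈ ball (0 : ℂ) 1, ∀ q : ℍ, ‖q‖ = ‖z‖ → ∀ l : ℂ, ‖f q‖ = ‖l‖ → ‖l‖ < M := by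
    intro z hz q hq l hl
    rw [← hl]
    exact hM q (by rw [mem_ball_zero_iff, hq]; simpa using hz)
  have hfne : ∀ l : ℂ, ‖l‖ < M → (M : ℂ) ^ 2 - ‖w‖ * l ≠ 0 := by
    intro l hl hzero
    have h1 := congrArg norm (sub_eq_zero.1 hzero)
    rw [norm_pow, norm_mul, Complex.norm_real, Complex.norm_real, norm_norm,
      Real.norm_of_nonneg hMp.le] at h1
    nlinarith [norm_nonneg l]
  have hdne : ∀ z ∈ ball (0 : ℂ) 1, dualForm A w M z ≠ 0 := by
    intro z hz
    obtain ⟨l₁, l₂, ⟨q₁, hq₁, e1⟩, ⟨q₂, hq₂, e2⟩, -, h4⟩ := h.eigenvalues hw0 hz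
    rw [h4]
    exact mul_ne_zero (hfne _ (hlM z hz _ hq₁ _ e1)) (hfne _ (hlM z hz _ hq₂ _ e2))
  have hfac : ∀ l : ℂ, ‖l‖ < M → M * ‖l - ‖w‖‖ ≤ ‖(M : ℂ) ^ 2 - ‖w‖ * l‖ := by
    intro l hl
    have h1 := normSq_moebius M ‖w‖ l
    have h2 : ‖(M : ℂ) * (l - ‖w‖)‖ = M * ‖l - ‖w‖‖ := by
      rw [norm_mul, Complex.norm_real, Real.norm_of_nonneg hMp.le]
    rw [h2] at h1
    have h3 : 0 ≤ (M ^ 2 - ‖w‖ ^ 2) * (M ^ 2 - ‖l‖ ^ 2) := by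
      apply mul_nonneg <;> nlinarith [norm_nonneg l]
    exact le_of_sq_le_sq (by linarith) (by positivity)
  have hdiv : DifferentiableOn ℂ (fun z => (M : ℂ) ^ 2 / dualForm A w M z) (ball 0 1) :=
    (differentiableOn_const _).div (h.differentiableOn_dualForm w M) hdne
  have hgd : DifferentiableOn ℂ (valueForm A w * fun z => (M : ℂ) ^ 2 / dualForm A w M z)
      (ball 0 1) := (h.differentiableOn_valueForm w).mul hdiv
  have hz₁ := toC_mem_ball.2 hp
  have hz₂ := toC_mem_ball.2 hq
  have key := norm_le_prod_zeros (toC p ::ₘ conj (toC p) ::ₘ toC q ::ₘ conj (toC q) ::ₘ 0)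
    (by
      intro b hb
      simp only [Multiset.mem_cons, Multiset.notMem_zero, or_false] at hb
      rcases hb with rfl | rfl | rfl | rfl
      · exact hz₁
      · simpa using hz₁
      · exact hz₂
      · simpa using hz₂) hgd
    (by
      intro z hz
      obtain ⟨l₁, l₂, ⟨q₁, hq₁, e1⟩, ⟨q₂, hq₂, e2⟩, h3, h4⟩ := h.eigenvalues hw0 hz
      have a1 := hfac _ (hlM z hz _ hq₁ _ e1)
      have a2 := hfac _ (hlM z hz _ hq₂ _ e2)
      simp only [Pi.mul_apply]
      rw [← mul_div_assoc, norm_div, div_le_one (norm_pos_iff.2 (hdne z hz)), h4, h3, norm_mul,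
        norm_mul, norm_mul, norm_pow, Complex.norm_real, Real.norm_of_nonneg hMp.le]
      calc _ = (M * ‖l₁ - ‖w‖‖) * (M * ‖l₂ - ‖w‖‖) := by ring
        _ ≤ _ := by gcongr)
    (by
      intro b hb
      rw [analyticOrderAt_mul
        ((h.differentiableOn_valueForm w).analyticAt (isOpen_ball.mem_nhds hb))
        (hdiv.analyticAt (isOpen_ball.mem_nhds hb))]
      refine le_trans ?_ le_self_add
      exact h.count_le_analyticOrderAt (imagUnit_mem p) (imagUnit_mem q) hz₁ hz₂
        (by rw [emb_toC, emb_toC]; exact hne) (by rw [emb_toC]) (by rw [emb_toC, ← hpq]) hb)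
  have hA := h.apply_zero h0
  have hg0 : (valueForm A w * fun z => (M : ℂ) ^ 2 / dualForm A w M z) 0 =
      ((‖w‖ ^ 2 / M ^ 2 : ℝ) : ℂ) := by
    simp only [Pi.mul_apply]
    rw [valueForm_of_zero hA, dualForm_of_zero hA]
    push_cast
    field_simp
  rw [hg0, Complex.norm_real, Real.norm_of_nonneg (by positivity)] at key
  simp only [Multiset.map_cons, Multiset.map_zero, Multiset.prod_cons, Multiset.prod_zero,
    RCLike.norm_conj, norm_toC, mul_one] at key
  rw [div_le_iff₀ (by positivity)] at key
  have : ‖w‖ ^ 2 ≤ (M * ‖p‖ * ‖q‖) ^ 2 := by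
    calc _ ≤ _ := key
      _ = _ := by ring
  exact le_of_sq_le_sq this (by positivity)

theorem hasDerivAt_comp {A : ℂ → Fin 4 → ℂ} {A' : Fin 4 → ℂ} {z : ℂ} (hA : HasDerivAt A A' z)
    (I : ℍ) : HasDerivAt (fun z => comp I (A z)) (comp I A') z := by
  have h := hasDerivAt_pi.1 hA
  exact (h 0).add (((((h 1).const_mul _).add ((h 2).const_mul _)).add
    ((h 3).const_mul _)).const_mul _)

theorem IsStem.differentiableOn_comp {f : ℍ → ℍ} {A : ℂ → Fin 4 → ℂ} (h : IsStem f A) (I : ℍ) :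
    DifferentiableOn ℂ (fun z => comp I (A z)) (ball 0 1) := fun _ hz =>
  (hasDerivAt_comp (h.hasDerivAt hz) I).differentiableAt.differentiableWithinAt

/-- The lower bound for `|f|` when `f` is bounded by `M` and `f'(0) = m`. -/
theorem IsStem.le_norm {f : ℍ → ℍ} {A : ℂ → Fin 4 → ℂ} (h : IsStem f A) (h0 : f 0 = 0)
    {m M : ℝ} (hm : 0 < m) (hmM : m < M) (hM : ∀ q ∈ ball (0 : ℍ) 1, ‖f q‖ < M)
    (hA' : deriv A 0 = ofQ m) {q : ℍ} (hq : q ∈ ball (0 : ℍ) 1) :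
    ‖q‖ * (M * (m - M * ‖q‖) / (M - m * ‖q‖)) ≤ ‖f q‖ := by
  set I := imagUnit q
  have hI : I ∈ imagSphere := imagUnit_mem q
  have hz := toC_mem_ball.2 hq
  have hd := h.differentiableOn_comp I
  have hc0 : comp I (A 0) = 0 := by rw [h.apply_zero h0]; simp [comp]
  have hc' : deriv (fun z => comp I (A z)) 0 = m := by
    rw [(hasDerivAt_comp (h.hasDerivAt (mem_ball_self one_pos)) I).deriv, hA']
    simp [comp]
  have hbd : ∀ z ∈ ball (0 : ℂ) 1, ‖comp I (A z)‖ ≤ M := by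
    intro z hz
    refine (norm_comp_le hI _).trans ?_
    rw [← h.eq I hI z hz]
    exact (hM _ ((emb_mem_ball hI).2 hz)).le
  have h1 := le_norm_of_schwarz_pick (h := dslope (fun z => comp I (A z)) 0)
    ((Complex.differentiableOn_dslope (ball_mem_nhds 0 one_pos)).2 hd) hm hmM
    (fun z hz => by
      have := Complex.norm_dslope_le_div_of_mapsTo_ball (R₂ := M) hd
        (fun z hz => by simpa [hc0] using hbd z hz) hz
      simpa using this) (by rw [dslope_same, hc']) hz
  rw [norm_toC] at h1
  have h2 := sub_smul_dslope (fun z => comp I (A z)) 0 (toC q)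
  rw [hc0, sub_zero, sub_zero, smul_eq_mul] at h2
  have h3 : ‖q‖ * ‖dslope (fun z => comp I (A z)) 0 (toC q)‖ ≤ ‖f q‖ := by
    rw [← norm_toC q, ← norm_mul, h2, h.apply_eq hq]
    exact norm_comp_le hI _
  exact (mul_le_mul_of_nonneg_left h1 (norm_nonneg q)).trans h3

/-- Landau's theorem: `f` is injective on the ball whose radius is the smaller root of
`m τ² - 2 M τ + m`. -/
theorem IsStem.injOn_ball {f : ℍ → ℍ} {A : ℂ → Fin 4 → ℂ} (h : IsStem f A) (h0 : f 0 = 0)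
    {m M : ℝ} (hm : 0 < m) (hmM : m < M) (hM : ∀ q ∈ ball (0 : ℍ) 1, ‖f q‖ < M)
    (hA' : deriv A 0 = ofQ m) {τ : ℝ} (hτ1 : τ < 1) (hτ : 2 * M * τ - m * τ ^ 2 = m) :
    InjOn f (ball 0 τ) := by
  have main : ∀ p ∈ ball (0 : ℍ) τ, ∀ q ∈ ball (0 : ℍ) τ, p ≠ 0 → p ≠ q → f p ≠ f q := by
    intro p hp q hq hp0 hne hpq
    have hpτ : ‖p‖ < τ := by simpa using hp
    have hqτ : ‖q‖ < τ := by simpa using hq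
    have hp1 := ball_subset_ball hτ1.le hp
    have hq1 := ball_subset_ball hτ1.le hq
    have h1 := h.norm_le_mul_mul h0 hM hp1 hq1 hne hpq
    have h2 := h.le_norm h0 hm hmM hM hA' hp1
    have hpp : 0 < ‖p‖ := norm_pos_iff.2 hp0
    have hM0 : 0 < M := hm.trans hmM
    have hden : 0 < M - m * ‖p‖ := by nlinarith
    have h3 : (‖p‖ * M) * ((m - M * ‖p‖) / (M - m * ‖p‖)) ≤ (‖p‖ * M) * ‖q‖ := by
      calc _ = ‖p‖ * (M * (m - M * ‖p‖) / (M - m * ‖p‖)) := by ring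
        _ ≤ _ := h2.trans h1
        _ = _ := by ring
    have h4 := le_of_mul_le_mul_left h3 (by positivity)
    rw [div_le_iff₀ hden] at h4
    have h5 : 0 < (τ - ‖p‖) * (M - m * τ) := mul_pos (by linarith) (by nlinarith)
    have h6 : 0 < (τ - ‖q‖) * (M - m * ‖p‖) := mul_pos (by linarith) hden
    nlinarith
  intro p hp q hq hpq
  by_contra hne
  by_cases hp0 : p = 0
  · exact main q hq p hp (fun hq0 => hne (hp0.trans hq0.symm)) (Ne.symm hne) hpq.symm
  · exact main p hp q hq hp0 hne hpq

/-- The lower bound for `|f|` on the sphere of radius `τ`, the smaller root of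
`m τ² - 2 M τ + m`. -/
theorem IsStem.mul_sq_le_norm {f : ℍ → ℍ} {A : ℂ → Fin 4 → ℂ} (h : IsStem f A) (h0 : f 0 = 0)
    {m M : ℝ} (hm : 0 < m) (hmM : m < M) (hM : ∀ q ∈ ball (0 : ℍ) 1, ‖f q‖ < M)
    (hA' : deriv A 0 = ofQ m) {τ : ℝ} (hτ1 : τ < 1) (hτ : 2 * M * τ - m * τ ^ 2 = m)
    {q : ℍ} (hq : ‖q‖ = τ) : M * τ ^ 2 ≤ ‖f q‖ := by
  have h1 := h.le_norm h0 hm hmM hM hA' (q := q) (by simpa [hq] using hτ1)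
  rw [hq] at h1
  have hτ0 : 0 ≤ τ := hq ▸ norm_nonneg q
  have hden : 0 < M - m * τ := by nlinarith
  have h2 : m - M * τ = τ * (M - m * τ) := by linarith
  rw [h2, ← mul_assoc, mul_div_assoc, div_self hden.ne'] at h1
  nlinarith

/-! ### Univalent balls -/

/-- A continuous function, injective on a ball and larger than `R` in norm on its boundary sphere,
maps the preimage of `B(0, R)` homeomorphically onto `B(0, R)`. -/
theorem hasUnivalentBall_of_injOn {f : ℍ → ℍ} (hc : ContinuousOn f (ball 0 1)) {τ R : ℝ}
    (hτ1 : τ < 1) (hinj : InjOn f (ball 0 τ)) (hR0 : 0 < R)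
    (hR : ∀ q : ℍ, ‖q‖ = τ → R < ‖f q‖) (hcov : ball (0 : ℍ) R ⊆ f '' ball (0 : ℍ) τ) :
    HasUnivalentBall f R := by
  have hc1 : ContinuousOn f (closedBall 0 τ) := hc.mono (closedBall_subset_ball hτ1)
  have hc2 : ContinuousOn f (ball 0 τ) := hc1.mono ball_subset_closedBall
  set K : Set ℍ := closedBall 0 τ ∩ f ⁻¹' closedBall 0 R with hK
  set Ω : Set ℍ := ball 0 τ ∩ f ⁻¹' ball 0 R with hΩ
  have hKτ : K ⊆ ball 0 τ := by
    rintro q ⟨hq1, hq2⟩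
    have h1 : ‖q‖ ≤ τ := by simpa using hq1
    have h2 : ‖f q‖ ≤ R := by simpa using hq2
    rcases h1.lt_or_eq with h3 | h3
    · simpa using h3
    · exact absurd (hR q h3) (not_lt.2 h2)
  have hΩK : Ω ⊆ K := fun q hq => ⟨ball_subset_closedBall hq.1, ball_subset_closedBall hq.2⟩
  have hKc : IsCompact K := by
    have : IsClosed K := hc1.preimage_isClosed_of_isClosed isClosed_closedBall isClosed_closedBall
    exact (isCompact_closedBall (0 : ℍ) τ).of_isClosed_subset this inter_subset_left
  have : CompactSpace K := isCompact_iff_compactSpace.1 hKc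
  -- On the compact set `K` the injective continuous map `f` is an embedding.
  have hemb : Topology.IsEmbedding (fun p : K => f p) :=
    (Continuous.isClosedEmbedding (continuousOn_iff_continuous_domRestrict.1 (hc2.mono hKτ))
      (fun a b hab => Subtype.ext (hinj (hKτ a.2) (hKτ b.2) hab))).isEmbedding
  have hembΩ : Topology.IsEmbedding (fun p : Ω => f p) :=
    hemb.comp (Topology.IsEmbedding.inclusion hΩK)
  have hrange : Set.range (fun p : Ω => f p) = ball (0 : ℍ) R := by
    ext w
    constructor
    · rintro ⟨p, rfl⟩
      exact p.2.2
    · intro hw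
      obtain ⟨q, hq, rfl⟩ := hcov hw
      exact ⟨⟨q, hq, hw⟩, rfl⟩
  set e : Ω ≃ₜ ball (0 : ℍ) R := hembΩ.toHomeomorph.trans (Homeomorph.setCongr hrange) with he
  refine ⟨0, Ω, hc2.isOpen_inter_preimage isOpen_ball isOpen_ball, ?_,
    inter_subset_left.trans (ball_subset_ball hτ1.le), e, fun p => rfl⟩
  have : ConnectedSpace (ball (0 : ℍ) R) :=
    isConnected_iff_connectedSpace.1
      ⟨⟨0, mem_ball_self hR0⟩, (convex_ball (0 : ℍ) R).isPreconnected⟩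
  exact isConnected_iff_connectedSpace.2 (e.symm.surjective.connectedSpace e.symm.continuous)

/-! ### Growth of normalized Bloch functions -/

theorem hasDerivAt_half_log {t : ℝ} (h1 : -1 < t) (h2 : t < 1) :
    HasDerivAt (fun t : ℝ => 1 / 2 * Real.log ((1 + t) / (1 - t))) (1 / (1 - t ^ 2)) t := by
  have a : 1 - t ≠ 0 := by linarith
  have b : 1 + t ≠ 0 := by linarith
  have c : 1 - t ^ 2 ≠ 0 := by nlinarith
  have h := (((hasDerivAt_id t).const_add 1).div ((hasDerivAt_id t).const_sub 1) a).log
    (div_ne_zero b a)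
  refine (h.const_mul (1 / 2)).congr_deriv ?_
  simp only [Pi.div_apply, id]
  field_simp
  ring

theorem half_log_lt {s t : ℝ} (hs : 0 ≤ s) (hst : s < t) (ht : t < 1) :
    1 / 2 * Real.log ((1 + s) / (1 - s)) < 1 / 2 * Real.log ((1 + t) / (1 - t)) := by
  rw [← Real.artanh_eq_half_log ⟨by linarith, by linarith⟩,
    ← Real.artanh_eq_half_log ⟨by linarith, by linarith⟩]
  exact Real.artanh_lt_artanh (by linarith) ht hst

theorem lt_half_log {r : ℝ} (h0 : 0 < r) (h1 : r < 1) :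
    r < 1 / 2 * Real.log ((1 + r) / (1 - r)) := by
  have h := Real.sum_range_le_log_div h0.le h1 2
  simp [Finset.sum_range_succ] at h
  have : 0 < r ^ 3 := by positivity
  linarith

/-- The hypotheses on a normalized Bloch function with `‖f‖ ≤ 1`, in terms of its stem. -/
structure IsNormalizedStem (f : ℍ → ℍ) (A : ℂ → Fin 4 → ℂ) : Prop extends IsStem f A where
  map_zero : f 0 = 0
  deriv_zero : deriv A 0 = ofQ 1
  bloch : ∀ I ∈ imagSphere, ∀ z ∈ ball (0 : ℂ) 1, (1 - ‖z‖ ^ 2) * ‖ev I (deriv A z)‖ ≤ 1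
  sliceDeriv_eq : ∀ I ∈ imagSphere, ∀ z ∈ ball (0 : ℂ) 1, sliceDeriv f (emb I z) = ev I (deriv A z)

theorem exists_isNormalizedStem {f : ℍ → ℍ} (hf : IsBloch f) (h0 : f 0 = 0)
    (h1 : sliceDeriv f 0 = 1) (hb : blochSeminorm f ≤ 1) : ∃ A, IsNormalizedStem f A := by
  obtain ⟨A, hA⟩ := exists_isStem hf.1
  have hs : ∀ I ∈ imagSphere, ∀ z ∈ ball (0 : ℂ) 1, sliceDeriv f (emb I z) = ev I (deriv A z) :=
    fun I hI z hz => hA.sliceDeriv_eq hf.1 hI hz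
  refine ⟨A, hA, h0, ?_, fun I hI z hz => ?_, hs⟩
  · have h2 : ∀ I ∈ imagSphere, ev I (deriv A 0 - ofQ 1) = 0 := by
      intro I hI
      have h3 := hs I hI 0 (mem_ball_self one_pos)
      have h4 : emb I 0 = 0 := by simp [emb, slicePoint]
      rw [h4, h1] at h3
      rw [ev_sub, ev_ofQ, ← h3, sub_self]
    exact sub_eq_zero.1 (eq_zero_of_ev_eq_zero (imagSphere_ne_neg quatI_mem) (h2 _ quatI_mem)
      (h2 _ (neg_mem_imagSphere quatI_mem)))
  · have h2 : ENNReal.ofReal ((1 - ‖emb I z‖ ^ 2) * ‖sliceDeriv f (emb I z)‖) ≤ 1 :=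
      (le_iSup₂ (f := fun q (_ : q ∈ ball (0 : ℍ) 1) =>
        ENNReal.ofReal ((1 - ‖q‖ ^ 2) * ‖sliceDeriv f q‖)) (emb I z)
        ((emb_mem_ball hI).2 hz)).trans hb
    rw [ENNReal.ofReal_le_one, norm_emb hI, hs I hI z hz] at h2
    exact h2

section Normalized

variable {f : ℍ → ℍ} {A : ℂ → Fin 4 → ℂ}

/-- A normalized Bloch function satisfies `|f(q)| ≤ artanh |q|`. -/
theorem IsNormalizedStem.norm_le (h : IsNormalizedStem f A) {q : ℍ} (hq : q ∈ ball (0 : ℍ) 1) :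
    ‖f q‖ ≤ 1 / 2 * Real.log ((1 + ‖q‖) / (1 - ‖q‖)) := by
  by_cases hq0 : q = 0
  · simp [hq0, h.map_zero]
  have hqp : 0 < ‖q‖ := norm_pos_iff.2 hq0
  have hq1 : ‖q‖ < 1 := by simpa using hq
  have hI := imagUnit_mem q
  set I := imagUnit q
  set e : ℂ := toC q / ‖q‖ with he
  have hen : ‖e‖ = 1 := by
    rw [he, norm_div, norm_toC, Complex.norm_real, norm_norm, div_self hqp.ne']
  have heq : (‖q‖ : ℂ) * e = toC q := by
    rw [he, mul_div_cancel₀]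
    exact_mod_cast hqp.ne'
  have hmem : ∀ t : ℝ, 0 ≤ t → t ≤ ‖q‖ → (t : ℂ) * e ∈ ball (0 : ℂ) 1 := by
    intro t h0 h1
    rw [mem_ball_zero_iff, norm_mul, hen, mul_one, Complex.norm_real, Real.norm_of_nonneg h0]
    linarith
  have hd : ∀ t : ℝ, 0 ≤ t → t ≤ ‖q‖ →
      HasDerivAt (fun t : ℝ => ev I (A (t * e))) (ev I (e • deriv A (t * e))) t := by
    intro t h0 h1
    have h2 : HasDerivAt (fun t : ℝ => (t : ℂ) * e) e t := by
      simpa using ((hasDerivAt_id (t : ℂ)).comp_ofReal).mul_const e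
    exact (evL I).hasFDerivAt.comp_hasDerivAt t (HasDerivAt.scomp t (h.hasDerivAt (hmem t h0 h1)) h2)
  have key := image_norm_le_of_norm_deriv_right_le_deriv_boundary'
    (f := fun t : ℝ => ev I (A (t * e))) (f' := fun t => ev I (e • deriv A (t * e))) (a := 0)
    (b := ‖q‖) (B := fun t => 1 / 2 * Real.log ((1 + t) / (1 - t)))
    (B' := fun t => 1 / (1 - t ^ 2))
    (fun t ht => (hd t ht.1 ht.2).continuousAt.continuousWithinAt)
    (fun t ht => (hd t ht.1 ht.2.le).hasDerivWithinAt)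
    (by
      have : A 0 = 0 := h.apply_zero h.map_zero
      simp [this, ev]
      have h1 : reQ 0 = 0 := by ext <;> simp
      have h2 : imQ 0 = 0 := by ext <;> simp
      rw [h1, h2]; simp)
    (fun t ht => (hasDerivAt_half_log (by linarith [ht.1])
      (by linarith [ht.2])).continuousAt.continuousWithinAt)
    (fun t ht => (hasDerivAt_half_log (by linarith [ht.1]) (by linarith [ht.2])).hasDerivWithinAt)
    (fun t ht => by
      have h1 := h.bloch I hI _ (hmem t ht.1 ht.2.le)
      rw [norm_mul, hen, mul_one, Complex.norm_real, Real.norm_of_nonneg ht.1] at h1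
      have h2 : 0 < 1 - t ^ 2 := by nlinarith [ht.1, ht.2]
      rw [ev_smul hI, norm_mul, norm_emb hI, hen, one_mul, le_div_iff₀ h2]
      linarith) (right_mem_Icc.2 hqp.le)
  simp only [heq] at key
  rwa [← h.apply_eq hq] at key

theorem IsNormalizedStem.differentiableOn_deriv_comp (h : IsNormalizedStem f A) (I : ℍ) :
    DifferentiableOn ℂ (fun z => comp I (deriv A z)) (ball 0 1) := by
  have h1 : DifferentiableOn ℂ (deriv fun z => comp I (A z)) (ball 0 1) :=
    (h.differentiableOn_comp I).deriv isOpen_ball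
  exact h1.congr fun z hz => (hasDerivAt_comp (h.hasDerivAt hz) I).deriv.symm

/-- Bonk's theorem for the `ℂ_I` component of `f'`, whose real part is that of `f'`. -/
theorem IsNormalizedStem.le_re_comp (h : IsNormalizedStem f A) {I : ℍ} (hI : I ∈ imagSphere)
    {z : ℂ} (hz : ‖z‖ < 1 / √3) :
    (1 - √3 * ‖z‖) / (1 - ‖z‖ / √3) ^ 3 ≤ (comp I (deriv A z)).re := by
  refine bonk_distortion (h.differentiableOn_deriv_comp I) ?_ (fun z hz => ?_) hz
  · rw [h.deriv_zero]; simp [comp]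
  · have h1 := h.bloch I hI z hz
    have h2 := norm_comp_le hI (deriv A z)
    have h3 : 0 ≤ 1 - ‖z‖ ^ 2 := by
      have : ‖z‖ < 1 := by simpa using hz
      nlinarith [norm_nonneg z]
    exact (mul_le_mul_of_nonneg_left h2 h3).trans h1

theorem one_div_sqrt_three_lt_one : 1 / √3 < 1 := by
  rw [div_lt_one (by positivity)]
  exact Real.lt_sqrt_of_sq_lt (by norm_num)

theorem IsNormalizedStem.le_re_sliceDeriv (h : IsNormalizedStem f A) {q : ℍ}
    (hq : q ∈ ball (0 : ℍ) (1 / √3)) :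
    (1 - √3 * ‖q‖) / (1 - ‖q‖ / √3) ^ 3 ≤ (sliceDeriv f q).re := by
  have hz : ‖toC q‖ < 1 / √3 := by rw [norm_toC]; simpa using hq
  have h1 := h.le_re_comp (imagUnit_mem q) hz
  have h2 := h.sliceDeriv_eq _ (imagUnit_mem q) (toC q)
    (mem_ball_zero_iff.2 (hz.trans one_div_sqrt_three_lt_one))
  rw [emb_toC] at h2
  rwa [norm_toC, comp_re (imagUnit_mem q), ← h2] at h1

/-- Injectivity on a slice: along a segment in the slice the derivative of the suitably rotated
`ℂ_I` component has positive real part. -/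
theorem IsNormalizedStem.injOn_slice (h : IsNormalizedStem f A) {I : ℍ} (hI : I ∈ imagSphere) :
    InjOn f (ball (0 : ℍ) (1 / √3) ∩ slicePlane I) := by
  rintro p ⟨hp, x₁, y₁, rfl⟩ q ⟨hq, x₂, y₂, rfl⟩ hpq
  set z₁ : ℂ := ⟨x₁, y₁⟩ with hz₁
  set z₂ : ℂ := ⟨x₂, y₂⟩ with hz₂
  change emb I z₁ = emb I z₂
  have hz₁b : z₁ ∈ ball (0 : ℂ) (1 / √3) := (emb_mem_ball hI).1 hp
  have hz₂b : z₂ ∈ ball (0 : ℂ) (1 / √3) := (emb_mem_ball hI).1 hq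
  have hsub : ball (0 : ℂ) (1 / √3) ⊆ ball 0 1 := ball_subset_ball one_div_sqrt_three_lt_one.le
  have hev : ev I (A z₁) = ev I (A z₂) := by
    rw [← h.eq I hI z₁ (hsub hz₁b), ← h.eq I hI z₂ (hsub hz₂b)]
    exact hpq
  have hc := comp_eq_of_ev_eq hI hev
  by_contra hne
  have hz : z₂ - z₁ ≠ 0 := fun h0 => hne (by rw [sub_eq_zero.1 h0])
  have hmem : ∀ t : ℝ, t ∈ Icc (0 : ℝ) 1 → z₁ + t * (z₂ - z₁) ∈ ball (0 : ℂ) (1 / √3) := by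
    intro t ht
    have := (convex_ball (0 : ℂ) (1 / √3)).add_smul_sub_mem hz₁b hz₂b ht
    simpa using this
  have hd : ∀ t : ℝ, t ∈ Icc (0 : ℝ) 1 → HasDerivAt
      (fun t : ℝ => (comp I (A (z₁ + t * (z₂ - z₁))) / (z₂ - z₁)).re)
      (comp I (deriv A (z₁ + t * (z₂ - z₁)))).re t := by
    intro t ht
    have h1 : HasDerivAt (fun s : ℂ => z₁ + s * (z₂ - z₁)) (z₂ - z₁) (t : ℂ) := by
      simpa using ((hasDerivAt_id (t : ℂ)).mul_const (z₂ - z₁)).const_add z₁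
    have h2 := ((hasDerivAt_comp (h.hasDerivAt (hsub (hmem t ht))) I).comp (t : ℂ) h1).div_const
      (z₂ - z₁)
    rw [mul_div_assoc, div_self hz, mul_one] at h2
    exact Complex.reCLM.hasFDerivAt.comp_hasDerivAt t h2.comp_ofReal
  have hmono : StrictMonoOn (fun t : ℝ => (comp I (A (z₁ + t * (z₂ - z₁))) / (z₂ - z₁)).re)
      (Icc 0 1) := by
    refine strictMonoOn_of_deriv_pos (convex_Icc 0 1)
      (fun t ht => (hd t ht).continuousAt.continuousWithinAt) fun t ht => ?_
    rw [interior_Icc] at ht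
    have ht' := Ioo_subset_Icc_self ht
    rw [(hd t ht').deriv]
    have hn : ‖z₁ + t * (z₂ - z₁)‖ < 1 / √3 := by simpa using hmem t ht'
    refine lt_of_lt_of_le ?_ (h.le_re_comp hI hn)
    have h3 : 0 < √3 := by positivity
    have h4 : √3 * ‖z₁ + t * (z₂ - z₁)‖ < 1 := by
      rw [lt_div_iff₀ h3] at hn; linarith
    have h5 : ‖z₁ + t * (z₂ - z₁)‖ / √3 < 1 := by
      rw [div_lt_one h3]
      have := one_div_sqrt_three_lt_one
      rw [div_lt_one h3] at this
      linarith [one_div_sqrt_three_lt_one]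
    exact div_pos (by linarith) (pow_pos (by linarith) 3)
  have := hmono (left_mem_Icc.2 zero_le_one) (right_mem_Icc.2 zero_le_one) zero_lt_one
  simp [hc] at this

/-- On the sphere of radius `1 / √3` a normalized Bloch function is at least `√3 / 4` in norm:
integrate Bonk's bound along the radius. -/
theorem IsNormalizedStem.sqrt_three_div_four_le (h : IsNormalizedStem f A) {q : ℍ}
    (hq : ‖q‖ = 1 / √3) : √3 / 4 ≤ ‖f q‖ := by
  have h3 : (√3) ^ 2 = 3 := Real.sq_sqrt (by norm_num)
  have h3p : 0 < √3 := by positivity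
  have hlt := one_div_sqrt_three_lt_one
  have hqp : 0 < ‖q‖ := by rw [hq]; positivity
  have hI := imagUnit_mem q
  set I := imagUnit q
  set e : ℂ := toC q / ‖q‖ with he
  have hen : ‖e‖ = 1 := by
    rw [he, norm_div, norm_toC, Complex.norm_real, norm_norm, div_self hqp.ne']
  have he0 : e ≠ 0 := by rw [← norm_ne_zero_iff, hen]; exact one_ne_zero
  have heq : ((1 / √3 : ℝ) : ℂ) * e = toC q := by
    rw [← hq, he, mul_div_cancel₀]
    exact_mod_cast hqp.ne'
  have hnt : ∀ t : ℝ, 0 ≤ t → ‖(t : ℂ) * e‖ = t := by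
    intro t ht
    rw [norm_mul, hen, mul_one, Complex.norm_real, Real.norm_of_nonneg ht]
  have hd : ∀ t ∈ Icc (0 : ℝ) (1 / √3), HasDerivAt (fun t : ℝ => (comp I (A (t * e)) / e).re)
      (comp I (deriv A (t * e))).re t := by
    intro t ht
    have h1 : HasDerivAt (fun s : ℂ => s * e) e (t : ℂ) := by
      simpa using (hasDerivAt_id (t : ℂ)).mul_const e
    have hm : (t : ℂ) * e ∈ ball (0 : ℂ) 1 := by
      rw [mem_ball_zero_iff, hnt t ht.1]; linarith [ht.2]
    have h2 := ((hasDerivAt_comp (h.hasDerivAt hm) I).comp (t : ℂ) h1).div_const e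
    rw [mul_div_assoc, div_self he0, mul_one] at h2
    exact Complex.reCLM.hasFDerivAt.comp_hasDerivAt t h2.comp_ofReal
  -- The primitive of Bonk's bound.
  set G : ℝ → ℝ := fun t => √3 / 4 * (1 - 3 * ((√3 * t - 1) / (√3 - t)) ^ 2) with hG
  have hGd : ∀ t ∈ Icc (0 : ℝ) (1 / √3),
      HasDerivAt G ((1 - √3 * t) / (1 - t / √3) ^ 3) t := by
    intro t ht
    have hts : t < √3 := by
      have : 1 < √3 := by rwa [div_lt_one h3p] at hlt
      linarith [ht.2]
    have hne : √3 - t ≠ 0 := by linarith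
    have h1 := (((((hasDerivAt_id t).const_mul √3).sub_const 1).div
      ((hasDerivAt_id t).const_sub √3) hne).pow 2).const_mul 3
    refine ((h1.const_sub 1).const_mul (√3 / 4)).congr_deriv ?_
    have e2 : 1 - t / √3 = (√3 - t) / √3 := by field_simp
    have e3 : √3 * 1 * (√3 - t) - (√3 * t - 1) * -1 = 2 := by linear_combination h3
    have e4 : √3 ^ 3 = 3 * √3 := by rw [pow_succ, h3]
    simp only [Pi.div_apply, id]
    rw [e2, e3, div_pow (√3 - t) √3 3, e4]
    generalize √3 - t = D at hne
    norm_num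
    field_simp
    ring
  have hmono : MonotoneOn (fun t : ℝ => (comp I (A (t * e)) / e).re - G t) (Icc 0 (1 / √3)) := by
    refine monotoneOn_of_deriv_nonneg (convex_Icc _ _)
      (fun t ht => ((hd t ht).sub (hGd t ht)).continuousAt.continuousWithinAt)
      (fun t ht => ?_) fun t ht => ?_
    · rw [interior_Icc] at ht
      have ht' := Ioo_subset_Icc_self ht
      exact ((hd t ht').sub (hGd t ht')).differentiableAt.differentiableWithinAt
    · rw [interior_Icc] at ht
      have ht' := Ioo_subset_Icc_self ht
      have hb := h.le_re_comp hI (z := (t : ℂ) * e) (by rw [hnt t ht.1.le]; exact ht.2)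
      rw [hnt t ht.1.le] at hb
      have hder := ((hd t ht').sub (hGd t ht')).deriv
      refine le_of_le_of_eq (sub_nonneg.2 hb) hder.symm
  have h1 := hmono (left_mem_Icc.2 (by positivity)) (right_mem_Icc.2 (by positivity))
    (by positivity : (0 : ℝ) ≤ 1 / √3)
  have hA0 : comp I (A 0) = 0 := by rw [h.apply_zero h.map_zero]; simp [comp]
  have hG0 : G 0 = 0 := by
    have : ((√3 * 0 - 1) / (√3 - 0)) ^ 2 = 1 / 3 := by
      rw [div_pow, sub_zero, h3]; norm_num
    simp only [hG]
    rw [this]; ring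
  have hG1 : G (1 / √3) = √3 / 4 := by
    simp only [hG]
    field_simp
    ring
  simp only [heq, hG1] at h1
  simp only [Complex.ofReal_zero, zero_mul, hA0, hG0, zero_div, Complex.zero_re, sub_zero] at h1
  have h2 : (comp I (A (toC q)) / e).re ≤ ‖f q‖ := by
    refine (le_abs_self _).trans ((Complex.abs_re_le_norm _).trans ?_)
    rw [norm_div, hen, div_one, h.apply_eq (by rw [mem_ball_zero_iff, hq]; exact hlt)]
    exact norm_comp_le hI _
  linarith

theorem IsNormalizedStem.ball_subset_image_sqrt_three (h : IsNormalizedStem f A) :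
    ball (0 : ℍ) (√3 / 4) ⊆ f '' ball (0 : ℍ) (1 / √3) :=
  h.ball_subset_image h.map_zero (by positivity) one_div_sqrt_three_lt_one
    fun _ hq => h.sqrt_three_div_four_le hq

/-! ### Landau's theorem at each radius -/

theorem injTerm_spec {r : ℝ} (h0 : 0 < r) (h1 : r < 1) :
    0 < injTerm r ∧ injTerm r < r ∧
      2 * (1 / 2 * Real.log ((1 + r) / (1 - r))) * injTerm r - injTerm r ^ 2 = r ^ 2 := by
  have hL := lt_half_log h0 h1
  set L := 1 / 2 * Real.log ((1 + r) / (1 - r)) with hLdef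
  have hterm : injTerm r = L - √(L ^ 2 - r ^ 2) := by
    rw [injTerm, hLdef]
    congr 2
    ring
  have hpos : 0 ≤ L ^ 2 - r ^ 2 := by nlinarith
  have hs := Real.sq_sqrt hpos
  have hs0 := Real.sqrt_nonneg (L ^ 2 - r ^ 2)
  rw [hterm]
  set s := √(L ^ 2 - r ^ 2)
  refine ⟨?_, ?_, ?_⟩
  · nlinarith
  · nlinarith
  · linear_combination (-1) * hs

theorem coverTerm_eq {r : ℝ} :
    coverTerm r = 1 / 2 * Real.log ((1 + r) / (1 - r)) * (injTerm r / r) ^ 2 := by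
  rw [coverTerm, div_pow]
  ring

/-- Landau's theorem for `q ↦ f(rq)`, bounded by `artanh r` on the unit ball. -/
theorem IsNormalizedStem.landau (h : IsNormalizedStem f A) {r : ℝ} (h0 : 0 < r) (h1 : r < 1) :
    InjOn f (ball 0 (injTerm r)) ∧ ∀ q : ℍ, ‖q‖ = injTerm r → coverTerm r ≤ ‖f q‖ := by
  obtain ⟨hρ0, hρr, hρ⟩ := injTerm_spec h0 h1
  have hL := lt_half_log h0 h1
  have hcov := coverTerm_eq (r := r)
  set L := 1 / 2 * Real.log ((1 + r) / (1 - r)) with hLdef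
  set g : ℍ → ℍ := fun q => f (r • q) with hg
  set B : ℂ → Fin 4 → ℂ := fun z => A (r * z) with hB
  have hmaps : MapsTo (fun z : ℂ => (r : ℂ) * z) (ball 0 1) (ball 0 1) := by
    intro z hz
    have hz1 : ‖z‖ < 1 := by simpa using hz
    rw [mem_ball_zero_iff, norm_mul, Complex.norm_real, Real.norm_of_nonneg h0.le]
    nlinarith [norm_nonneg z]
  have hemb : ∀ (I : ℍ) (z : ℂ), r • emb I z = emb I (r * z) := by
    intro I z
    simp only [emb, slicePoint, smul_add, Complex.re_ofReal_mul, Complex.im_ofReal_mul,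
      Quaternion.coe_mul, ← Quaternion.coe_mul_eq_smul, mul_assoc]
  have hstem : IsStem g B := by
    refine ⟨h.diff.comp (by fun_prop) hmaps, fun I hI z hz => ?_⟩
    rw [hg]
    simp only
    rw [hemb, h.eq I hI _ (hmaps hz)]
  have hg0 : g 0 = 0 := by simp [hg, h.map_zero]
  have hgM : ∀ q ∈ ball (0 : ℍ) 1, ‖g q‖ < L := by
    intro q hq
    have hq1 : ‖q‖ < 1 := by simpa using hq
    have hn : ‖r • q‖ = r * ‖q‖ := by rw [norm_smul, Real.norm_of_nonneg h0.le]
    have hlt : r * ‖q‖ < r := by nlinarith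
    refine (h.norm_le (q := r • q) (by rw [mem_ball_zero_iff, hn]; linarith)).trans_lt ?_
    rw [hn]
    exact half_log_lt (by positivity) hlt h1
  have hB' : deriv B 0 = ofQ r := by
    have d1 : HasDerivAt (fun z : ℂ => (r : ℂ) * z) r 0 := by
      simpa using (hasDerivAt_id (0 : ℂ)).const_mul (r : ℂ)
    have d2 : HasDerivAt A (deriv A 0) ((fun z : ℂ => (r : ℂ) * z) 0) := by
      simpa using h.hasDerivAt (mem_ball_self one_pos)
    refine (HasDerivAt.deriv (f := B) (HasDerivAt.scomp (0 : ℂ) d2 d1)).trans ?_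
    rw [h.deriv_zero]
    funext j
    fin_cases j <;> simp
  set τ := injTerm r / r with hτdef
  have hτ1 : τ < 1 := (div_lt_one h0).2 hρr
  have hρτ : injTerm r = r * τ := by rw [hτdef]; field_simp
  have hτ : 2 * L * τ - r * τ ^ 2 = r := by
    rw [hρτ] at hρ
    have : r * (2 * L * τ - r * τ ^ 2) = r * r := by linarith
    exact mul_left_cancel₀ h0.ne' this
  have hscale : ∀ q : ℍ, f q = g (r⁻¹ • q) := by
    intro q
    simp only [hg, smul_smul, mul_inv_cancel₀ h0.ne', one_smul]
  have hsn : ∀ q : ℍ, ‖r⁻¹ • q‖ = ‖q‖ / r := by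
    intro q
    rw [norm_smul, norm_inv, Real.norm_of_nonneg h0.le]
    ring
  constructor
  · have hinj := hstem.injOn_ball hg0 h0 hL hgM hB' hτ1 hτ
    intro p hp q hq hpq
    rw [hscale p, hscale q] at hpq
    have hball : ∀ q ∈ ball (0 : ℍ) (injTerm r), r⁻¹ • q ∈ ball (0 : ℍ) τ := by
      intro q hq
      have : ‖q‖ < injTerm r := by simpa using hq
      rw [mem_ball_zero_iff, hsn, hτdef]
      exact div_lt_div_of_pos_right this h0
    have := hinj (hball p hp) (hball q hq) hpq
    exact smul_right_injective ℍ (inv_ne_zero h0.ne') this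
  · intro q hq
    rw [hcov, hscale q]
    exact hstem.mul_sq_le_norm hg0 h0 hL hgM hB' hτ1 hτ (by rw [hsn, hq])

theorem IsNormalizedStem.ball_subset_image_coverTerm (h : IsNormalizedStem f A) {r : ℝ}
    (h0 : 0 < r) (h1 : r < 1) :
    ball (0 : ℍ) (coverTerm r) ⊆ f '' ball (0 : ℍ) (injTerm r) := by
  obtain ⟨hρ0, hρr, -⟩ := injTerm_spec h0 h1
  exact h.ball_subset_image h.map_zero hρ0 (hρr.trans h1) (h.landau h0 h1).2

theorem IsNormalizedStem.hasUnivalentBall (h : IsNormalizedStem f A) {r R : ℝ} (h0 : 0 < r)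
    (h1 : r < 1) (hR0 : 0 < R) (hR : R < coverTerm r) : HasUnivalentBall f R := by
  obtain ⟨hρ0, hρr, -⟩ := injTerm_spec h0 h1
  obtain ⟨l1, l2⟩ := h.landau h0 h1
  exact hasUnivalentBall_of_injOn h.continuousOn (hρr.trans h1) l1 hR0
    (fun q hq => hR.trans_le (l2 q hq))
    ((ball_subset_ball hR.le).trans (h.ball_subset_image_coverTerm h0 h1))

end Normalized

/-! ### Numerical values of the two radii -/

theorem add_cube_div_three_le_half_log {r : ℝ} (h0 : 0 ≤ r) (h1 : r < 1) :
    r + r ^ 3 / 3 ≤ 1 / 2 * Real.log ((1 + r) / (1 - r)) := by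
  have h := Real.sum_range_le_log_div h0 h1 2
  simp [Finset.sum_range_succ] at h
  linarith

theorem injTerm_le_of_le_half_log {r b : ℝ} (h0 : 0 < r) (h1 : r < 1) (hb : 0 < b)
    (h : (r ^ 2 + b ^ 2) / (2 * b) ≤ 1 / 2 * Real.log ((1 + r) / (1 - r))) : injTerm r ≤ b := by
  obtain ⟨hρ0, hρr, hρ⟩ := injTerm_spec h0 h1
  rw [div_le_iff₀ (by positivity)] at h
  by_contra hcon
  push Not at hcon
  have h2 : 0 ≤ (injTerm r - b) * (b * injTerm r - r ^ 2) := by nlinarith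
  have h3 : b * injTerm r < r ^ 2 := by nlinarith
  nlinarith [mul_pos (sub_pos.2 hcon) (sub_pos.2 h3)]

theorem le_injTerm_of_half_log_le {r b : ℝ} (h0 : 0 < r) (h1 : r < 1) (hb : 0 < b) (hbr : b < r)
    (h : 1 / 2 * Real.log ((1 + r) / (1 - r)) ≤ (r ^ 2 + b ^ 2) / (2 * b)) : b ≤ injTerm r := by
  obtain ⟨hρ0, hρr, hρ⟩ := injTerm_spec h0 h1
  rw [le_div_iff₀ (by positivity)] at h
  by_contra hcon
  push Not at hcon
  have h2 : (injTerm r - b) * (b * injTerm r - r ^ 2) ≤ 0 := by nlinarith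
  have h3 : b * injTerm r < r ^ 2 := by nlinarith
  nlinarith [mul_pos (sub_pos.2 hcon) (sub_pos.2 h3)]

theorem half_log_sub_nonneg_at : ((0.703665 : ℝ) ^ 2 + (0.703665 - 0.703665 ^ 3) ^ 2) /
    (2 * (0.703665 - 0.703665 ^ 3)) ≤
      1 / 2 * Real.log ((1 + 0.703665) / (1 - 0.703665)) := by
  refine le_trans ?_ (Real.sum_range_le_log_div (x := 0.703665) (by norm_num) (by norm_num) 20)
  norm_num [Finset.sum_range_succ]

/-- The parameter `b = r₀ - r₀³` is chosen so that `artanh r - (r² + b²) / (2b)` has its local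
minimum exactly at `r₀`, where it is still positive. -/
theorem injTerm_le {r : ℝ} (h0 : 0 < r) (h1 : r < 1) :
    injTerm r ≤ 0.703665 - 0.703665 ^ 3 := by
  have hnum := half_log_sub_nonneg_at
  set c : ℝ := 0.703665 with hc
  set b : ℝ := c - c ^ 3 with hb
  have hb1 : 0.3552 < b := by rw [hb, hc]; norm_num
  have hb2 : b < 0.3553 := by rw [hb, hc]; norm_num
  clear_value b c
  have hb0 : 0 < b := by linarith
  by_cases hrb : r ≤ b
  · exact ((injTerm_spec h0 h1).2.1.le).trans hrb
  push Not at hrb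
  refine injTerm_le_of_le_half_log h0 h1 hb0 ?_
  by_cases hr1 : r ≤ 0.45
  · refine le_trans ?_ (add_cube_div_three_le_half_log h0.le h1)
    rw [div_le_iff₀ (by positivity)]
    have e1 : (r - b) ^ 2 ≤ 0.009025 := by nlinarith
    have e2 : 0.0447 ≤ r ^ 3 := by
      have : (0.3552 : ℝ) ^ 3 ≤ r ^ 3 := by gcongr; linarith
      norm_num at this ⊢
      linarith
    nlinarith
  push Not at hr1
  set φ : ℝ → ℝ := fun x => 1 / 2 * Real.log ((1 + x) / (1 - x)) - (x ^ 2 + b ^ 2) / (2 * b)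
    with hφ
  have hd : ∀ x : ℝ, 0 ≤ x → x < 1 → HasDerivAt φ (1 / (1 - x ^ 2) - x / b) x := by
    intro x hx0 hx1
    have h2 := (((hasDerivAt_id x).pow 2).add_const (b ^ 2)).div_const (2 * b)
    refine ((hasDerivAt_half_log (by linarith) hx1).sub h2).congr_deriv ?_
    simp only [id]
    field_simp
    norm_num
    ring
  have hder : ∀ x : ℝ, 0 ≤ x → x < 1 → 1 / (1 - x ^ 2) - x / b =
      (x - c) * (x ^ 2 + x * c + c ^ 2 - 1) / ((1 - x ^ 2) * b) := by
    intro x hx0 hx1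
    have : 1 - x ^ 2 ≠ 0 := by nlinarith
    rw [div_sub_div _ _ this hb0.ne', hb]
    congr 1
    ring
  have hQ : ∀ x : ℝ, 0.45 ≤ x → 0 < x ^ 2 + x * c + c ^ 2 - 1 := by
    intro x hx
    rw [hc]
    nlinarith
  have hφc : 0 ≤ φ c := by
    simp only [hφ]; linarith
  suffices hs : 0 ≤ φ r by simp only [hφ] at hs; linarith
  rcases le_total r c with hrc | hrc
  · have hmono : AntitoneOn φ (Icc 0.45 c) := by
      have hlt : ∀ x ∈ Icc (0.45 : ℝ) c, 0 ≤ x ∧ x < 1 := fun x hx =>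
        ⟨by linarith [hx.1], by have := hx.2; rw [hc] at this; linarith⟩
      refine antitoneOn_of_deriv_nonpos (convex_Icc _ _)
        (fun x hx => (hd x (hlt x hx).1 (hlt x hx).2).continuousAt.continuousWithinAt)
        (fun x hx => ?_) fun x hx => ?_
      all_goals
        rw [interior_Icc] at hx
        obtain ⟨a1, a2⟩ := hlt x (Ioo_subset_Icc_self hx)
      · exact (hd x a1 a2).differentiableAt.differentiableWithinAt
      · rw [(hd x a1 a2).deriv, hder x a1 a2]
        have := hQ x hx.1.le
        refine div_nonpos_of_nonpos_of_nonneg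
          (mul_nonpos_of_nonpos_of_nonneg (by linarith [hx.2]) this.le)
          (mul_nonneg (by nlinarith) hb0.le)
    exact hφc.trans (hmono ⟨hr1.le, hrc⟩ ⟨by rw [hc]; norm_num, le_rfl⟩ hrc)
  · have hmono : MonotoneOn φ (Icc c r) := by
      have hlt : ∀ x ∈ Icc c r, 0.45 ≤ x ∧ x < 1 := fun x hx =>
        ⟨by have := hx.1; rw [hc] at this; linarith, by linarith [hx.2]⟩
      have hlt0 : ∀ x ∈ Icc c r, 0 ≤ x := fun x hx => by linarith [(hlt x hx).1]
      refine monotoneOn_of_deriv_nonneg (convex_Icc _ _)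
        (fun x hx => (hd x (hlt0 x hx) (hlt x hx).2).continuousAt.continuousWithinAt)
        (fun x hx => ?_) fun x hx => ?_
      all_goals
        rw [interior_Icc] at hx
        obtain ⟨a1, a2⟩ := hlt x (Ioo_subset_Icc_self hx)
        have a0 := hlt0 x (Ioo_subset_Icc_self hx)
      · exact (hd x a0 a2).differentiableAt.differentiableWithinAt
      · rw [(hd x a0 a2).deriv, hder x a0 a2]
        exact div_nonneg (mul_nonneg (by linarith [hx.1]) (hQ x a1).le)
          (mul_nonneg (by nlinarith) hb0.le)
    exact hφc.trans (hmono ⟨le_rfl, hrc⟩ ⟨hrc, le_rfl⟩ hrc)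

theorem le_injTerm_at : 0.3552 ≤ injTerm 0.703665 := by
  refine le_injTerm_of_half_log_le (by norm_num) (by norm_num) (by norm_num) (by norm_num) ?_
  refine (Real.log_div_le_sum_range_add (x := 0.703665) (by norm_num) (by norm_num) 18).trans ?_
  norm_num [Finset.sum_range_succ]

theorem isLUB_injRadius : IsLUB (injTerm '' Ioo 0 1) injRadius := by
  refine isLUB_csSup ⟨_, ⟨0.703665, by norm_num, rfl⟩⟩ ⟨0.703665 - 0.703665 ^ 3, ?_⟩
  rintro _ ⟨r, hr, rfl⟩
  exact injTerm_le hr.1 hr.2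

theorem abs_injRadius_sub_lt : |injRadius - 0.3552| < 0.00005 := by
  have h1 : injRadius ≤ 0.703665 - 0.703665 ^ 3 :=
    isLUB_injRadius.2 (by rintro _ ⟨r, hr, rfl⟩; exact injTerm_le hr.1 hr.2)
  have h2 : 0.3552 ≤ injRadius :=
    le_injTerm_at.trans (isLUB_injRadius.1 ⟨0.703665, by norm_num, rfl⟩)
  rw [abs_lt]
  constructor
  · linarith
  · have : (0.703665 : ℝ) - 0.703665 ^ 3 - 0.3552 < 0.00005 := by norm_num
    linarith

theorem coverTerm_eq_injTerm {r : ℝ} (h0 : 0 < r) (h1 : r < 1) :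
    coverTerm r = injTerm r * (injTerm r ^ 2 + r ^ 2) / (2 * r ^ 2) := by
  obtain ⟨-, -, hρ⟩ := injTerm_spec h0 h1
  rw [coverTerm_eq, div_pow]
  have h2 : injTerm r ^ 2 + r ^ 2 =
    2 * (1 / 2 * Real.log ((1 + r) / (1 - r))) * injTerm r := by linarith
  rw [h2]
  field_simp

theorem le_coverTerm_at : 0.230755 ≤ coverTerm 0.57902 := by
  have h1 : 0.3421 ≤ injTerm 0.57902 := by
    refine le_injTerm_of_half_log_le (by norm_num) (by norm_num) (by norm_num) (by norm_num) ?_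
    refine (Real.log_div_le_sum_range_add (x := 0.57902) (by norm_num) (by norm_num) 12).trans ?_
    norm_num [Finset.sum_range_succ]
  rw [coverTerm_eq_injTerm (by norm_num) (by norm_num), le_div_iff₀ (by norm_num)]
  have h2 : (0.3421 : ℝ) * (0.3421 ^ 2 + 0.57902 ^ 2) ≤
      injTerm 0.57902 * (injTerm 0.57902 ^ 2 + 0.57902 ^ 2) := by gcongr
  refine le_trans ?_ h2
  norm_num

/-- A bound for `tanh (B s²)` gives a bound for `coverTerm`. Here `s² = artanh r / B`. -/
theorem coverTerm_le_of_forall {B : ℝ} (hB : 0 < B)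
    (h : ∀ s : ℝ, 1 ≤ s → 2 * B * s ^ 3 / (1 + s ^ 2) < 1 →
      B * s ^ 2 ≤ 1 / 2 * Real.log ((1 + 2 * B * s ^ 3 / (1 + s ^ 2)) /
        (1 - 2 * B * s ^ 3 / (1 + s ^ 2)))) {r : ℝ} (h0 : 0 < r) (h1 : r < 1) :
    coverTerm r ≤ B := by
  obtain ⟨hρ0, hρr, hρ⟩ := injTerm_spec h0 h1
  have hL := lt_half_log h0 h1
  have hcov := coverTerm_eq (r := r)
  have hart := Real.artanh_eq_half_log (x := r) ⟨by linarith, h1.le⟩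
  set L := 1 / 2 * Real.log ((1 + r) / (1 - r)) with hLdef
  have hL0 : 0 < L := h0.trans hL
  set τ := injTerm r / r with hτdef
  have hτ0 : 0 < τ := div_pos hρ0 h0
  have hτ1 : τ < 1 := (div_lt_one h0).2 hρr
  have hρτ : injTerm r = r * τ := by rw [hτdef]; field_simp
  have hτ : 2 * L * τ = r * (1 + τ ^ 2) := by
    rw [hρτ] at hρ
    have : r * (2 * L * τ) = r * (r * (1 + τ ^ 2)) := by linarith
    exact mul_left_cancel₀ h0.ne' this
  by_contra hcon
  push Not at hcon
  rw [hcov] at hcon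
  set s := √(L / B) with hs
  have hs2 : s ^ 2 = L / B := Real.sq_sqrt (by positivity)
  have hLs : L = B * s ^ 2 := by rw [hs2]; field_simp
  have hsp : 0 < s := Real.sqrt_pos.2 (by positivity)
  have hsτ : 1 < s * τ := by
    have : 1 < (s * τ) ^ 2 := by
      have : B * 1 < B * (s * τ) ^ 2 := by rw [hLs] at hcon; linarith
      exact lt_of_mul_lt_mul_left this hB.le
    nlinarith [mul_pos hsp hτ0]
  have hs1 : 1 < s := by nlinarith
  have hrs : r ≤ 2 * B * s ^ 3 / (1 + s ^ 2) := by
    by_cases hlt : 2 * B * s ^ 3 / (1 + s ^ 2) < 1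
    · have h2 := h s hs1.le hlt
      have hpos : 0 < 2 * B * s ^ 3 / (1 + s ^ 2) := by positivity
      rw [← Real.artanh_eq_half_log ⟨by linarith, hlt.le⟩, ← hLs, ← hart] at h2
      exact (Real.artanh_le_artanh_iff ⟨by linarith, h1⟩ ⟨by linarith, hlt⟩).1 h2
    · push Not at hlt
      linarith
  rw [le_div_iff₀ (by positivity)] at hrs
  rw [hLs] at hτ
  have h3 : (1 + τ ^ 2) * (r * (1 + s ^ 2)) ≤ (1 + τ ^ 2) * (2 * B * s ^ 3) := by gcongr
  have h4 : (2 * B * s ^ 2) * (τ * (1 + s ^ 2)) ≤ (2 * B * s ^ 2) * (s * (1 + τ ^ 2)) := by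
    calc _ = (2 * (B * s ^ 2) * τ) * (1 + s ^ 2) := by ring
      _ = (1 + τ ^ 2) * (r * (1 + s ^ 2)) := by rw [hτ]; ring
      _ ≤ _ := h3
      _ = _ := by ring
  have h5 := le_of_mul_le_mul_left h4 (by positivity)
  nlinarith [mul_pos (sub_pos.2 (hτ1.trans hs1)) (sub_pos.2 hsτ)]

/-- The critical value of the parameter `s` in the estimate of `coverTerm`. -/
noncomputable def critS : ℝ := 1.6921

/-- The bound for `coverTerm`: its square is chosen so that `artanh (2Bs³ / (1 + s²)) - B s²` has
its local minimum exactly at `critS`, where it is still positive. -/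
noncomputable def critB : ℝ := √(((1 + critS ^ 2) ^ 2 - 3 * critS - critS ^ 3) / critS ^ 6) / 2

theorem critB_sq : 4 * critB ^ 2 =
    ((1 + critS ^ 2) ^ 2 - 3 * critS - critS ^ 3) / critS ^ 6 := by
  rw [critB, div_pow, Real.sq_sqrt (by norm_num [critS])]
  ring

theorem lt_critB : 0.23084270 < critB := by
  rw [critB, lt_div_iff₀ (by norm_num)]
  exact Real.lt_sqrt_of_sq_lt (by norm_num [critS])

theorem critB_lt : critB < 0.23084280 := by
  rw [critB, div_lt_iff₀ (by norm_num), Real.sqrt_lt' (by norm_num)]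
  norm_num [critS]

theorem critB_mul_sq_le_at : critB * critS ^ 2 ≤
    1 / 2 * Real.log ((1 + 2 * critB * critS ^ 3 / (1 + critS ^ 2)) /
      (1 - 2 * critB * critS ^ 3 / (1 + critS ^ 2))) := by
  have h1 := lt_critB
  have h2 := critB_lt
  have h3 : 0.578997 < 2 * critB * critS ^ 3 / (1 + critS ^ 2) := by
    rw [lt_div_iff₀ (by norm_num [critS])]
    norm_num [critS]
    linarith
  have h4 : 2 * critB * critS ^ 3 / (1 + critS ^ 2) < 1 := by
    rw [div_lt_one (by norm_num [critS])]
    norm_num [critS]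
    linarith
  refine le_trans ?_ (half_log_lt (s := 0.578997) (by norm_num) h3 h4).le
  refine le_trans ?_ (Real.sum_range_le_log_div (x := 0.578997) (by norm_num) (by norm_num) 14)
  have h5 : critB * critS ^ 2 ≤ 0.23084280 * critS ^ 2 := by gcongr
  refine h5.trans ?_
  norm_num [critS, Finset.sum_range_succ]

theorem critB_mul_sq_le {s : ℝ} (hs : 1 ≤ s) (hlt : 2 * critB * s ^ 3 / (1 + s ^ 2) < 1) :
    critB * s ^ 2 ≤ 1 / 2 * Real.log ((1 + 2 * critB * s ^ 3 / (1 + s ^ 2)) /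
      (1 - 2 * critB * s ^ 3 / (1 + s ^ 2))) := by
  have hnum := critB_mul_sq_le_at
  have hE := critB_sq
  have hB1 := lt_critB
  have hB2 := critB_lt
  set B := critB
  have hB0 : 0 < B := by linarith
  set R : ℝ → ℝ := fun x => 2 * B * x ^ 3 / (1 + x ^ 2) with hR
  have hRpos : ∀ x : ℝ, 0 ≤ x → 0 ≤ R x := fun x hx => by simp only [hR]; positivity
  by_cases hs1 : s ≤ 1.3
  · refine le_trans ?_ (add_cube_div_three_le_half_log (hRpos s (by linarith)) hlt)
    have hq : 0 < 1 + s ^ 2 := by positivity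
    -- After division by `B s²` the claim is `(1 + s²)² (s - 1)² ≤ (8 B² / 3) s⁷`.
    have hpoly : (1 + s ^ 2) ^ 2 * (s - 1) ^ 2 ≤ 8 * B ^ 2 / 3 * s ^ 7 := by
      obtain ⟨t, rfl⟩ : ∃ t, s = 1 + t := ⟨s - 1, by ring⟩
      have ht0 : 0 ≤ t := by linarith
      have ht1 : t ≤ 0.3 := by linarith
      have hBB : 0.142 ≤ 8 * B ^ 2 / 3 := by nlinarith
      have e1 : 1 + (1 + t) ^ 2 ≤ 2.1 * (1 + t) := by nlinarith
      have e2 : (1 + (1 + t) ^ 2) ^ 2 ≤ (2.1 * (1 + t)) ^ 2 := by gcongr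
      have e3 : 1 + 5 * t + 10 * t ^ 2 ≤ (1 + t) ^ 5 := by
        have : 0 ≤ 10 * t ^ 3 + 5 * t ^ 4 + t ^ 5 := by positivity
        nlinarith
      have e4 : 4.41 * t ^ 2 ≤ 0.142 * (1 + t) ^ 5 := by nlinarith
      calc (1 + (1 + t) ^ 2) ^ 2 * (1 + t - 1) ^ 2
          ≤ (2.1 * (1 + t)) ^ 2 * (1 + t - 1) ^ 2 := by gcongr
        _ = (1 + t) ^ 2 * (4.41 * t ^ 2) := by ring
        _ ≤ (1 + t) ^ 2 * (0.142 * (1 + t) ^ 5) := by gcongr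
        _ = 0.142 * (1 + t) ^ 7 := by ring
        _ ≤ _ := by gcongr
    have hdiff : 2 * B * s ^ 3 / (1 + s ^ 2) + (2 * B * s ^ 3 / (1 + s ^ 2)) ^ 3 / 3 - B * s ^ 2 =
        B * s ^ 2 * (8 * B ^ 2 / 3 * s ^ 7 - (1 + s ^ 2) ^ 2 * (s - 1) ^ 2) / (1 + s ^ 2) ^ 3 := by
      field_simp
      ring
    have : 0 ≤ B * s ^ 2 * (8 * B ^ 2 / 3 * s ^ 7 - (1 + s ^ 2) ^ 2 * (s - 1) ^ 2) /
        (1 + s ^ 2) ^ 3 := by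
      have := sub_nonneg.2 hpoly
      positivity
    linarith
  push Not at hs1
  set χ : ℝ → ℝ := fun x => 1 / 2 * Real.log ((1 + R x) / (1 - R x)) - B * x ^ 2 with hχ
  have hRd : ∀ x : ℝ, HasDerivAt R (2 * B * x ^ 2 * (3 + x ^ 2) / (1 + x ^ 2) ^ 2) x := by
    intro x
    have hq : 1 + x ^ 2 ≠ 0 := by positivity
    have h1 := (((hasDerivAt_id x).pow 3).const_mul (2 * B)).div
      (((hasDerivAt_id x).pow 2).const_add 1) hq
    refine h1.congr_deriv ?_
    simp only [id, Pi.pow_apply]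
    field_simp
    norm_num
    ring
  have hRmono : MonotoneOn R (Ici 0) := by
    refine monotoneOn_of_deriv_nonneg (convex_Ici 0)
      (fun x _ => (hRd x).continuousAt.continuousWithinAt)
      (fun x _ => (hRd x).differentiableAt.differentiableWithinAt) fun x _ => ?_
    rw [(hRd x).deriv]
    positivity
  have hd : ∀ x : ℝ, 0 ≤ x → R x < 1 → HasDerivAt χ
      (1 / (1 - R x ^ 2) * (2 * B * x ^ 2 * (3 + x ^ 2) / (1 + x ^ 2) ^ 2) - 2 * B * x) x := by
    intro x hx hx1
    have h1 := HasDerivAt.comp x (hasDerivAt_half_log (by linarith [hRpos x hx]) hx1) (hRd x)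
    have h2 := ((hasDerivAt_id x).pow 2).const_mul B
    refine (h1.sub h2).congr_deriv ?_
    simp only [id]
    norm_num
    ring
  have hder : ∀ x : ℝ, 0 ≤ x → R x < 1 →
      0 < (1 + x ^ 2) ^ 2 - 4 * B ^ 2 * x ^ 6 ∧
      1 / (1 - R x ^ 2) * (2 * B * x ^ 2 * (3 + x ^ 2) / (1 + x ^ 2) ^ 2) - 2 * B * x =
        2 * B * x * (x * (3 + x ^ 2) - ((1 + x ^ 2) ^ 2 - 4 * B ^ 2 * x ^ 6)) /
          ((1 + x ^ 2) ^ 2 - 4 * B ^ 2 * x ^ 6) := by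
    intro x hx hx1
    have hq : 0 < 1 + x ^ 2 := by positivity
    have e1 : 1 - R x ^ 2 = ((1 + x ^ 2) ^ 2 - 4 * B ^ 2 * x ^ 6) / (1 + x ^ 2) ^ 2 := by
      simp only [hR]
      field_simp
      ring
    have hp : 0 < 1 - R x ^ 2 := by nlinarith [hRpos x hx]
    have hW : 0 < (1 + x ^ 2) ^ 2 - 4 * B ^ 2 * x ^ 6 := by
      rw [e1] at hp
      exact (div_pos_iff_of_pos_right (by positivity)).1 hp
    refine ⟨hW, ?_⟩
    rw [e1]
    generalize (1 + x ^ 2) ^ 2 - 4 * B ^ 2 * x ^ 6 = W at hW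
    field_simp
  -- The numerator of the derivative vanishes at `critS` by the choice of `critB`.
  have hfac : ∃ Q : ℝ → ℝ, (∀ x, 1.3 ≤ x → 0 < Q x) ∧ ∀ x,
      x * (3 + x ^ 2) - ((1 + x ^ 2) ^ 2 - 4 * B ^ 2 * x ^ 6) = (x - critS) * Q x := by
    set E : ℝ := 4 * B ^ 2 with hEdef
    set c : ℝ := critS with hc
    have hc0 : c ≠ 0 := by rw [hc, critS]; norm_num
    have hE1 : E * c ^ 6 = (1 + c ^ 2) ^ 2 - 3 * c - c ^ 3 := by
      rw [hE]; field_simp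
    refine ⟨fun x => E * x ^ 5 + E * c * x ^ 4 + (E * c ^ 2 - 1) * x ^ 3 +
      (E * c ^ 3 - c + 1) * x ^ 2 + (E * c ^ 4 - c ^ 2 + c - 2) * x +
      (E * c ^ 5 - c ^ 3 + c ^ 2 - 2 * c + 3), ?_, fun x => by linear_combination hE1⟩
    intro x hx
    have hE2 : 0.21315 < E := by rw [hEdef]; nlinarith
    obtain ⟨t, rfl⟩ : ∃ t, x = 1.3 + t := ⟨x - 1.3, by ring⟩
    have ht : 0 ≤ t := by linarith
    have hpos : ∀ E' : ℝ, 0 ≤ E' → 0 ≤ E' * ((1.3 + t) ^ 5 + c * (1.3 + t) ^ 4 +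
        c ^ 2 * (1.3 + t) ^ 3 + c ^ 3 * (1.3 + t) ^ 2 + c ^ 4 * (1.3 + t) + c ^ 5) := by
      intro E' hE'
      have : 0 < c := by rw [hc, critS]; norm_num
      positivity
    have h1 := hpos (E - 0.21315) (by linarith)
    have h2 : 0 < 0.21315 * (1.3 + t) ^ 5 + 0.21315 * c * (1.3 + t) ^ 4 +
        (0.21315 * c ^ 2 - 1) * (1.3 + t) ^ 3 + (0.21315 * c ^ 3 - c + 1) * (1.3 + t) ^ 2 +
        (0.21315 * c ^ 4 - c ^ 2 + c - 2) * (1.3 + t) +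
        (0.21315 * c ^ 5 - c ^ 3 + c ^ 2 - 2 * c + 3) := by
      rw [hc, critS]
      ring_nf
      positivity
    linarith
  obtain ⟨Q, hQ, hfac⟩ := hfac
  have hχc : 0 ≤ χ critS := by simp only [hχ, hR]; linarith
  have hcS : critS = 1.6921 := rfl
  have hRs : R s < 1 := hlt
  suffices hsuff : 0 ≤ χ s by simp only [hχ, hR] at hsuff; linarith
  rcases le_total s critS with hsc | hsc
  · have hRc : R critS < 1 := by
      simp only [hR]
      rw [div_lt_one (by positivity), hcS]
      norm_num
      linarith
    have hlt1 : ∀ x ∈ Icc (1.3 : ℝ) critS, 0 ≤ x ∧ R x < 1 := fun x hx =>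
      have hx0 : 0 ≤ x := by linarith [hx.1]
      ⟨hx0, (hRmono hx0 (hx0.trans hx.2) hx.2).trans_lt hRc⟩
    have hmono : AntitoneOn χ (Icc 1.3 critS) := by
      refine antitoneOn_of_deriv_nonpos (convex_Icc _ _)
        (fun x hx => (hd x (hlt1 x hx).1 (hlt1 x hx).2).continuousAt.continuousWithinAt)
        (fun x hx => ?_) fun x hx => ?_
      all_goals
        rw [interior_Icc] at hx
        obtain ⟨a1, a2⟩ := hlt1 x (Ioo_subset_Icc_self hx)
      · exact (hd x a1 a2).differentiableAt.differentiableWithinAt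
      · obtain ⟨b1, b2⟩ := hder x a1 a2
        rw [(hd x a1 a2).deriv, b2, hfac]
        refine div_nonpos_of_nonpos_of_nonneg (mul_nonpos_of_nonneg_of_nonpos (by positivity)
          (mul_nonpos_of_nonpos_of_nonneg (by linarith [hx.2]) (hQ x hx.1.le).le)) b1.le
    exact hχc.trans (hmono ⟨hs1.le, hsc⟩ ⟨by rw [hcS]; norm_num, le_rfl⟩ hsc)
  · have hlt1 : ∀ x ∈ Icc critS s, 1.3 ≤ x ∧ 0 ≤ x ∧ R x < 1 := fun x hx =>
      have hx0 : 1.3 ≤ x := by have := hx.1; rw [hcS] at this; linarith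
      have hx1 : 0 ≤ x := by linarith
      ⟨hx0, hx1, (hRmono hx1 (hx1.trans hx.2) hx.2).trans_lt hRs⟩
    have hmono : MonotoneOn χ (Icc critS s) := by
      refine monotoneOn_of_deriv_nonneg (convex_Icc _ _)
        (fun x hx => (hd x (hlt1 x hx).2.1 (hlt1 x hx).2.2).continuousAt.continuousWithinAt)
        (fun x hx => ?_) fun x hx => ?_
      all_goals
        rw [interior_Icc] at hx
        obtain ⟨a0, a1, a2⟩ := hlt1 x (Ioo_subset_Icc_self hx)
      · exact (hd x a1 a2).differentiableAt.differentiableWithinAt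
      · obtain ⟨b1, b2⟩ := hder x a1 a2
        rw [(hd x a1 a2).deriv, b2, hfac]
        exact div_nonneg (mul_nonneg (by positivity)
          (mul_nonneg (by linarith [hx.1]) (hQ x a0).le)) b1.le
    exact hχc.trans (hmono ⟨le_rfl, hsc⟩ ⟨hsc, le_rfl⟩ hsc)

theorem coverTerm_le {r : ℝ} (h0 : 0 < r) (h1 : r < 1) : coverTerm r ≤ critB :=
  coverTerm_le_of_forall (by linarith [lt_critB]) (fun _ hs hlt => critB_mul_sq_le hs hlt) h0 h1

theorem isLUB_coverRadius : IsLUB (coverTerm '' Ioo 0 1) coverRadius := by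
  refine isLUB_csSup ⟨_, ⟨0.57902, by norm_num, rfl⟩⟩ ⟨critB, ?_⟩
  rintro _ ⟨r, hr, rfl⟩
  exact coverTerm_le hr.1 hr.2

theorem abs_coverRadius_sub_lt : |coverRadius - 0.2308| < 0.00005 := by
  have h1 : coverRadius ≤ critB :=
    isLUB_coverRadius.2 (by rintro _ ⟨r, hr, rfl⟩; exact coverTerm_le hr.1 hr.2)
  have h2 : 0.230755 ≤ coverRadius :=
    le_coverTerm_at.trans (isLUB_coverRadius.1 ⟨0.57902, by norm_num, rfl⟩)
  have h3 := critB_lt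
  rw [abs_lt]
  constructor <;> linarith

end SliceBloch

/-! ### The distortion and covering theorem -/

theorem theorem1p2 :
    (∀ f : ℍ → ℍ, SliceBloch.IsBloch f → f 0 = 0 → SliceBloch.sliceDeriv f 0 = 1 →
      SliceBloch.blochSeminorm f ≤ 1 →
        (∀ q ∈ ball (0 : ℍ) (1 / Real.sqrt 3),
          (1 - Real.sqrt 3 * ‖q‖) / (1 - ‖q‖ / Real.sqrt 3) ^ 3 ≤
            (SliceBloch.sliceDeriv f q).re) ∧
        (∀ I ∈ SliceBloch.imagSphere,
          InjOn f (ball (0 : ℍ) (1 / Real.sqrt 3) ∩ SliceBloch.slicePlane I)) ∧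
        InjOn f (ball (0 : ℍ) SliceBloch.injRadius) ∧
        ball (0 : ℍ) SliceBloch.coverRadius ⊆ f '' ball (0 : ℍ) SliceBloch.injRadius ∧
        ball (0 : ℍ) (Real.sqrt 3 / 4) ⊆ f '' ball (0 : ℍ) (1 / Real.sqrt 3)) ∧
    IsLUB (SliceBloch.injTerm '' Ioo 0 1) SliceBloch.injRadius ∧
    |SliceBloch.injRadius - 0.3552| < 0.00005 ∧
    IsLUB (SliceBloch.coverTerm '' Ioo 0 1) SliceBloch.coverRadius ∧
    |SliceBloch.coverRadius - 0.2308| < 0.00005 ∧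
    ENNReal.ofReal 0.23 < SliceBloch.blochConstant := by
  refine ⟨fun f hf h0 h1 hb => ?_, SliceBloch.isLUB_injRadius, SliceBloch.abs_injRadius_sub_lt,
    SliceBloch.isLUB_coverRadius, SliceBloch.abs_coverRadius_sub_lt, ?_⟩
  · obtain ⟨A, h⟩ := SliceBloch.exists_isNormalizedStem hf h0 h1 hb
    refine ⟨fun q hq => h.le_re_sliceDeriv hq, fun I hI => h.injOn_slice hI, ?_, ?_,
      h.ball_subset_image_sqrt_three⟩
    · intro p hp q hq hpq
      rw [mem_ball_zero_iff] at hp hq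
      -- Some `injTerm r` exceeds both norms.
      obtain ⟨_, ⟨r, hr, rfl⟩, hlt⟩ :=
        (lt_isLUB_iff SliceBloch.isLUB_injRadius).1 (max_lt hp hq)
      exact (h.landau hr.1 hr.2).1 (by simpa using (le_max_left _ _).trans_lt hlt)
        (by simpa using (le_max_right _ _).trans_lt hlt) hpq
    · intro w hw
      rw [mem_ball_zero_iff] at hw
      obtain ⟨_, ⟨r, hr, rfl⟩, hlt⟩ := (lt_isLUB_iff SliceBloch.isLUB_coverRadius).1 hw
      obtain ⟨q, hq, hqw⟩ := h.ball_subset_image_coverTerm hr.1 hr.2 (mem_ball_zero_iff.2 hlt)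
      exact ⟨q, ball_subset_ball (SliceBloch.isLUB_injRadius.1 ⟨r, hr, rfl⟩) hq, hqw⟩
  · refine lt_of_lt_of_le (b := ENNReal.ofReal 0.2305)
      ((ENNReal.ofReal_lt_ofReal_iff (by norm_num)).2 (by norm_num)) ?_
    refine le_iInf₂ fun f ⟨hf, h0, h1, hb⟩ => ?_
    obtain ⟨A, h⟩ := SliceBloch.exists_isNormalizedStem hf h0 h1 hb
    have hU := h.hasUnivalentBall (r := 0.57902) (R := 0.2305) (by norm_num) (by norm_num)
      (by norm_num) (lt_of_lt_of_le (by norm_num) SliceBloch.le_coverTerm_at)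
    exact le_iSup₂ (f := fun (R : ℝ) (_ : 0 < R ∧ SliceBloch.HasUnivalentBall f R) =>
      ENNReal.ofReal R) 0.2305 ⟨by norm_num, hU⟩
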